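/- Let $d\ge 1$ be an integer and $H\in(0,1)$. A $d$-dimensional fractional Brownian motion (fBm) with Hurst index $H$ is a process $B=(B_t)_{t\ge 0}$ in $\mathbb R^d$ whose coordinates are independent centered Gaussian processes with covariance $\mathbb E[B^i_sB^i_t]=\frac12\left(t^{2H}+s^{2H}-|t-s|^{2H}\right)$; it is taken jointly measurable in $(t,\omega)$ (up to null sets; this holds for instance if its paths are almost surely continuous). For $\beta>0$ and $T>0$ put $$L_T(y)=\left|\{t\in[0,T]: |B_t-y|<1\}\right|,\quad \mathcal E_T=\exp\Big(-\beta\int_{\mathbb R^d}L_T(z)^2\,dz\Big),\quad \mathbb Q_T(A)=\frac{\mathbb E[\mathbf 1_A\mathcal E_T]}{\mathbb E[\mathcal E_T]},$$ $$\overline B_T=\frac1T\int_0^TB_t\,dt,\qquad R_T=\Big(\frac1T\int_0^T|B_t-\overline B_T|^2\,dt\Big)^{1/2}.$$ Define $\gamma=\gamma_{d,H}(\beta)$ and $F=F_{d,H}(T)$ as follows. - If $dH<1$: $\gamma=\beta^{\frac{2(1-H)}{3-(d+2)H}}$ and $F=T^{1+\frac{(1-2H)(1-dH)}{3-(d+2)H}}$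 (for $d=1$ these are $\beta^{2/3}$ and $T^{2(2-H)/3}$). - If $dH=1$ and $H=\frac12$ (so $d=2$): $\gamma=\beta^{1/2}$ for $\beta\le1$, $\gamma=\beta^{2/3}$ for $\beta>1$, and $F=T$. - If $dH=1$ and $H<\frac12$: $\gamma=\beta$ and $F=T\log T$. - If $dH>1$ and $H\ge\frac12$: $\gamma=\beta^{2/3}$ and $F=T^{2(2-H)/3}$. - If $dH>1$ and $H<\frac12$: $\gamma=\beta$ and $F=T$. Let $$\underline R_T=\Big(\frac{\beta T^2}{\gamma F}\Big)^{1/d},\qquad \overline R_T=\left(\gamma\,T^{2H}F\right)^{1/2},\qquad c_d=\frac{9\,\pi^{d/2}}{2^{5+d}\,\Gamma(1+d/2)}.$$ **Theorem.** For all $d\ge1$ and $H\in(0,1)$ there are constants $C_1,C_2>0$, depending only on $d$ and $H$, such that, with $$C_*=\Big(\frac{c_d}{2C_1}\Big)^{1/d},\qquad C^*=\Big(\frac{2C_1}{C_2}\Big)^{1/2},$$ the following holds. For every $\beta>0$ there is a nonrandom $T_\beta\ge e$ such that, for all $T\ge T_\beta$, $$\mathbb Q_T\left(C_*\,\underline R_T\le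 R_T\le C^*\,\overline R_T\right)\ \ge\ 1-2\exp\left(-C_1\,\gamma_{d,H}(\beta)\,F_{d,H}(T)\right).$$ -/

import Mathlib

open MeasureTheory ProbabilityTheory
open scoped NNReal

noncomputable section

namespace SelfRepellent

/-- `B` is a `d`-dimensional fractional Brownian motion with Hurst index `H` under `P`:
its coordinate processes are independent centered Gaussian processes on `[0, ∞)` with covariance
`(t^{2H} + s^{2H} - |t - s|^{2H}) / 2`. The time index is written as a real number, and only the
values `B t` with `t ≥ 0` are constrained or used. -/
structure IsFBM {Ω : Type*} [MeasurableSpace Ω] {d : ℕ} (H : ℝ)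
    (B : ℝ → Ω → EuclideanSpace ℝ (Fin d)) (P : Measure Ω) : Prop where
  indep : iIndepFun (fun (i : Fin d) (ω : Ω) (t : ℝ≥0) => B t ω i) P
  gaussian : ∀ i : Fin d, IsGaussianProcess (fun (t : ℝ≥0) (ω : Ω) => B t ω i) P
  centered : ∀ (i : Fin d) (t : ℝ), 0 ≤ t → ∫ ω, B t ω i ∂P = 0
  covariance : ∀ (i : Fin d) (s t : ℝ), 0 ≤ s → 0 ≤ t →
    ∫ ω, B s ω i * B t ω i ∂P = (1 / 2) * (t ^ (2 * H) + s ^ (2 * H) - |t - s| ^ (2 * H))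

section Path

variable {d : ℕ}

/-- The time that the path `b` spends in the open unit ball around `y` during `[0, T]`. -/
def occupationTime (b : ℝ → EuclideanSpace ℝ (Fin d)) (T : ℝ) (y : EuclideanSpace ℝ (Fin d)) : ℝ :=
  volume.real {t : ℝ | t ∈ Set.Icc 0 T ∧ b t ∈ Metric.ball y 1}

/-- The penalty `exp (-β ∫ L_T(z)² dz)`. -/
def penalty (β : ℝ) (b : ℝ → EuclideanSpace ℝ (Fin d)) (T : ℝ) : ℝ :=
  Real.exp (-β * ∫ z : EuclideanSpace ℝ (Fin d), occupationTime b T z ^ 2)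

/-- The time average of the path over `[0, T]`. -/
def timeMean (b : ℝ → EuclideanSpace ℝ (Fin d)) (T : ℝ) : EuclideanSpace ℝ (Fin d) :=
  (1 / T) • ∫ t in (0 : ℝ)..T, b t

/-- The radius of gyration of the path over `[0, T]`. -/
def gyrationRadius (b : ℝ → EuclideanSpace ℝ (Fin d)) (T : ℝ) : ℝ :=
  Real.sqrt ((1 / T) * ∫ t in (0 : ℝ)..T, ‖b t - timeMean b T‖ ^ 2)

end Path

section Law

variable {Ω : Type*} [MeasurableSpace Ω] {d : ℕ}

/-- The normalisation `Z_T`, the expectation of the penalty. -/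
def partitionFunction (P : Measure Ω) (B : ℝ → Ω → EuclideanSpace ℝ (Fin d)) (β T : ℝ) : ℝ :=
  ∫ ω, penalty β (fun t => B t ω) T ∂P

/-- The probability `Q_T(A) = Z_T⁻¹ E[1_A exp (-β ∫ L_T(z)² dz)]` of an event `A` for the
self-repellent process. -/
def repellentProb (P : Measure Ω) (B : ℝ → Ω → EuclideanSpace ℝ (Fin d)) (β T : ℝ)
    (A : Set Ω) : ℝ :=
  (1 / partitionFunction P B β T) *
    ∫ ω, A.indicator (fun ω => penalty β (fun t => B t ω) T) ω ∂P

end Law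

/-- `β^{a,b}`, equal to `β^a` for `0 < β ≤ 1` and to `β^b` for `β > 1`. -/
def splitPow (β a b : ℝ) : ℝ := if β ≤ 1 then β ^ a else β ^ b

open Classical in
/-- The coefficient `γ_{d,H}(β)`. For `d = 1` it equals `β^{2/3}`. -/
def gammaCoeff (d : ℕ) (H β : ℝ) : ℝ :=
  if d * H < 1 then β ^ (2 * (1 - H) / (3 - (d + 2) * H))
  else if d * H = 1 then
    if H = 1 / 2 then splitPow β (1 / 2) (2 / 3) else β
  else
    if 1 / 2 ≤ H then β ^ (2 / 3 : ℝ) else β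

open Classical in
/-- The growth function `F_{d,H}(T)`. For `d = 1` it equals `T^{2(2-H)/3}`. -/
def growthF (d : ℕ) (H T : ℝ) : ℝ :=
  if d * H < 1 then T ^ (1 + (1 - 2 * H) * (1 - d * H) / (3 - (d + 2) * H))
  else if d * H = 1 then
    if H = 1 / 2 then T else T * Real.log T
  else
    if 1 / 2 ≤ H then T ^ (2 * (2 - H) / 3) else T

/-- The lower scale `(β T² / (γ F))^{1/d}`. -/
def lowerRadius (d : ℕ) (H β T : ℝ) : ℝ :=
  (β * T ^ 2 / (gammaCoeff d H β * growthF d H T)) ^ (1 / (d : ℝ))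

/-- The upper scale `(γ T^{2H} F)^{1/2}`. -/
def upperRadius (d : ℕ) (H β T : ℝ) : ℝ :=
  (gammaCoeff d H β * T ^ (2 * H) * growthF d H T) ^ (1 / 2 : ℝ)

/-- The constant `9 K_d / 2^{5+d}`, where `K_d = π^{d/2} / Γ(1 + d/2)` is the volume of the unit
ball of `ℝ^d`. -/
def ballConst (d : ℕ) : ℝ :=
  9 * (Real.pi ^ ((d : ℝ) / 2) / Real.Gamma (1 + (d : ℝ) / 2)) / 2 ^ (5 + d)

end SelfRepellent

end

/-! Everything rests on a lower bound `exp (-N)` for the partition function, with `N = C γ F`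
(`exists_partitionLowerBound`). Given it, paths whose penalized mass is at most `exp (-2N)` have
probability at most `exp (-N)` under the repellent law, and two families of paths are discarded in
this way (`one_sub_le_repellentProb`). A path with radius of gyration below `x` spends at least
three quarters of its time within `2x` of its mean, so by Cauchy-Schwarz its energy is at least of
order `T² / (2x+1)^d` (`le_integral_occupationTime_sq`); the lower radius is the `x` that makes the
penalty at most `exp (-2N)`. At the other end, the squared radius of gyration exceeds `x T^{2H}`
with probability at most `exp (-x/8)` (`IsFBM.measure_gyrationRadius_ge_le`), and `x = 16 N` gives
the upper radius.

The partition function is bounded below by Gibbs' variational principle: for every density `D`, its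
logarithm is at least minus `β` times the mean energy under `D`, minus the relative entropy of `D`.
Here `D` is the Cameron-Martin density `exp (a B_T^i - a² T^{2H} / 2)`. It gives `B_t - B_s` a mean
`a Cov (B_T, B_t - B_s)` in one coordinate, which is at least `v (t - s)` for a suitable `a`
(`mul_le_endpoint_covariance`), at an entropy of order `v² T^{2-2H}`. The mean energy is controlled
by tilted return probabilities, hence by `T ∫ q`, where `q(u)` is at most of order `u^{-dH}` and
gains a factor `exp (-v² u^{2-2H} / 4)` once `v u ≥ 8`.

It remains to choose `v`. If `H ≥ 1/2`, the cost `β T / v + v² T^{2-2H}` is balanced. If `H < 1/2`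
and `dH < 1`, the first term becomes `β T v^{-(1-dH)/(1-H)}`. If `H < 1/2` and `dH ≥ 1`, no drift is
needed: the integral of `u^{-dH}` over `[1, T]` is logarithmic or bounded. -/

namespace SelfRepellent

/-! ### Gaussian estimates: small balls, tilting, square-exponential moments. -/

section Gaussian

variable {Ω : Type*} [MeasurableSpace Ω] {P : Measure Ω}

/-- The density is at most `1 / √(2πv)`, the interval has length 4, and `√(2π) ≥ 2`. -/
lemma gaussianReal_abs_lt_two_le {v : ℝ≥0} (hv : v ≠ 0) :
    gaussianReal 0 v {x | |x| < 2} ≤ ENNReal.ofReal (2 / √(v : ℝ)) := by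
  have hv' : (0 : ℝ) < v := by positivity
  rw [gaussianReal_apply 0 hv]
  have hset : {x : ℝ | |x| < 2} = Set.Ioo (-2) 2 := by
    ext x; simp [abs_lt]
  calc ∫⁻ x in {x : ℝ | |x| < 2}, gaussianPDF 0 v x
      ≤ ∫⁻ x in {x : ℝ | |x| < 2}, ENNReal.ofReal ((√(2 * Real.pi * v))⁻¹) := by
        refine lintegral_mono fun x => ENNReal.ofReal_le_ofReal ?_
        rw [gaussianPDFReal_def]
        refine mul_le_of_le_one_right (by positivity) (Real.exp_le_one_iff.mpr ?_)
        rw [neg_div]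
        exact neg_nonpos.mpr (by positivity)
    _ = ENNReal.ofReal (4 * (√(2 * Real.pi * v))⁻¹) := by
        rw [lintegral_const, hset, Measure.restrict_apply_univ, Real.volume_Ioo,
          ← ENNReal.ofReal_mul (by positivity)]
        congr 1; ring
    _ ≤ ENNReal.ofReal (2 / √(v : ℝ)) := by
        refine ENNReal.ofReal_le_ofReal ?_
        rw [Real.sqrt_mul (by positivity)]
        have h1 : 2 ≤ √(2 * Real.pi) := by
          apply Real.le_sqrt_of_sq_le
          nlinarith [Real.pi_gt_three]
        have h2 : 0 < √(v : ℝ) := Real.sqrt_pos.mpr hv'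
        rw [mul_inv, div_eq_mul_inv, ← mul_assoc]
        gcongr
        rw [← div_eq_mul_inv, div_le_iff₀ (by positivity)]
        linarith

lemma lintegral_exp_mul_gaussianReal (v : ℝ≥0) (a : ℝ) :
    ∫⁻ x, ENNReal.ofReal (Real.exp (a * x)) ∂(gaussianReal 0 v)
      = ENNReal.ofReal (Real.exp (v * a ^ 2 / 2)) := by
  rw [← ofReal_integral_eq_lintegral_ofReal (integrable_exp_mul_gaussianReal a)
    (ae_of_all _ fun _ => (Real.exp_pos _).le)]
  congr 1
  have := congrFun (mgf_fun_id_gaussianReal (μ := 0) (v := v)) a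
  simpa [mgf] using this

lemma HasGaussianLaw.map_eq_of_centered {X : Ω → ℝ} (hX : HasGaussianLaw X P)
    (h0 : ∫ ω, X ω ∂P = 0) :
    P.map X = gaussianReal 0 (∫ ω, X ω * X ω ∂P).toNNReal := by
  rw [hX.map_eq_gaussianReal, h0, variance_of_integral_eq_zero hX.aemeasurable h0]
  simp [sq]

lemma lintegral_exp_mul_of_centered {X : Ω → ℝ} (hX : HasGaussianLaw X P)
    (h0 : ∫ ω, X ω ∂P = 0) (a : ℝ) :
    ∫⁻ ω, ENNReal.ofReal (Real.exp (a * X ω)) ∂P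
      = ENNReal.ofReal (Real.exp ((∫ ω, X ω * X ω ∂P) * a ^ 2 / 2)) := by
  have h := lintegral_exp_mul_gaussianReal (∫ ω, X ω * X ω ∂P).toNNReal a
  rw [← HasGaussianLaw.map_eq_of_centered hX h0, lintegral_map' (by fun_prop) hX.aemeasurable] at h
  rw [h, Real.coe_toNNReal _ (integral_nonneg fun ω => mul_self_nonneg _)]

/-- Tilting by `exp (a X)` a Gaussian variable `Y` correlated with `X`. -/
lemma lintegral_indicator_mul_exp_le {X Y : Ω → ℝ}
    (hXY : HasGaussianLaw (fun ω => (X ω, Y ω)) P)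
    (hX0 : ∫ ω, X ω ∂P = 0) (hY0 : ∫ ω, Y ω ∂P = 0) {σ2 c τ2 a : ℝ}
    (hσ : ∫ ω, X ω * X ω ∂P = σ2) (hc : ∫ ω, X ω * Y ω ∂P = c) (hτ : ∫ ω, Y ω * Y ω ∂P = τ2)
    (hτ0 : 0 < τ2) :
    ∫⁻ ω, Set.indicator {y : ℝ | |y| < 2} 1 (Y ω)
        * ENNReal.ofReal (Real.exp (a * X ω - a ^ 2 * σ2 / 2)) ∂P
      ≤ min 1 (ENNReal.ofReal (2 / √τ2))
        * ENNReal.ofReal (Real.exp (2 * |a * c / τ2| - (a * c / τ2) ^ 2 * τ2 / 2)) := by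
  have hP := hXY.isProbabilityMeasure
  -- The regression coefficient of `X` on `Y`: the residual `X - r Y` is uncorrelated with `Y`,
  -- hence independent of it by joint Gaussianity, so the expectation factors.
  set r := c / τ2 with hr
  have hX2 := hXY.fst.memLp_two
  have hY2 := hXY.snd.memLp_two
  have hXm : AEMeasurable X P := hXY.fst.aemeasurable
  have hYm : AEMeasurable Y P := hXY.snd.aemeasurable
  have iXX : Integrable (fun ω => X ω * X ω) P := hX2.integrable_mul hX2
  have iXY : Integrable (fun ω => X ω * Y ω) P := hX2.integrable_mul hY2
  have iYY : Integrable (fun ω => Y ω * Y ω) P := hY2.integrable_mul hY2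
  have iX : Integrable X P := hXY.fst.integrable
  have iY : Integrable Y P := hXY.snd.integrable
  have hWY : HasGaussianLaw (fun ω => (X ω - r * Y ω, Y ω)) P :=
    hXY.map_fun (((ContinuousLinearMap.fst ℝ ℝ ℝ) - r • (ContinuousLinearMap.snd ℝ ℝ ℝ)).prod
      (ContinuousLinearMap.snd ℝ ℝ ℝ))
  have hW0 : ∫ ω, (X ω - r * Y ω) ∂P = 0 := by
    rw [integral_sub iX (iY.const_mul r), integral_const_mul, hX0, hY0]; simp
  have hWYc : ∫ ω, (X ω - r * Y ω) * Y ω ∂P = 0 := by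
    have : (fun ω => (X ω - r * Y ω) * Y ω) = fun ω => X ω * Y ω - r * (Y ω * Y ω) := by
      ext; ring
    rw [this, integral_sub iXY (iYY.const_mul r), integral_const_mul, hc, hτ, hr]
    field_simp; ring
  have hWW : ∫ ω, (X ω - r * Y ω) * (X ω - r * Y ω) ∂P = σ2 - r ^ 2 * τ2 := by
    have : (fun ω => (X ω - r * Y ω) * (X ω - r * Y ω))
        = fun ω => X ω * X ω - r * (2 * (X ω * Y ω) - r * (Y ω * Y ω)) := by
      ext; ring
    have hi : Integrable (fun ω => r * (2 * (X ω * Y ω) - r * (Y ω * Y ω))) P :=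
      ((iXY.const_mul 2).sub (iYY.const_mul r)).const_mul r
    rw [this, integral_sub iXX hi, integral_const_mul, integral_sub (iXY.const_mul 2) (iYY.const_mul r), integral_const_mul,
      integral_const_mul, hc, hτ, hσ, hr]
    field_simp; ring
  have hind : IndepFun (fun ω => X ω - r * Y ω) Y P := by
    refine hWY.indepFun_of_covariance_eq_zero ?_
    rw [covariance_eq_sub hWY.fst.memLp_two hY2]
    simp only [Pi.mul_apply, hWYc, hW0, hY0]
    simp
  have hYlaw := HasGaussianLaw.map_eq_of_centered hXY.snd hY0
  rw [hτ] at hYlaw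
  have hprob : P {ω | |Y ω| < 2} ≤ min 1 (ENNReal.ofReal (2 / √τ2)) := by
    refine le_min prob_le_one ?_
    have h1 : P {ω | |Y ω| < 2} = (P.map Y) {y | |y| < 2} := by
      rw [Measure.map_apply_of_aemeasurable hYm (measurableSet_lt (by fun_prop) (by fun_prop))]
      rfl
    rw [h1, hYlaw]
    have := gaussianReal_abs_lt_two_le (v := τ2.toNNReal) (by simpa using hτ0)
    rwa [Real.coe_toNNReal _ hτ0.le] at this
  set S : Set ℝ := {y : ℝ | |y| < 2} with hS
  have hSm : MeasurableSet S := measurableSet_lt (by fun_prop) (by fun_prop)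
  set f : ℝ → ENNReal := fun y => S.indicator 1 y * ENNReal.ofReal (Real.exp (a * r * y)) with hf
  have hfm : Measurable f := (measurable_one.indicator hSm).mul (by fun_prop)
  set g : ℝ → ENNReal := fun w => ENNReal.ofReal (Real.exp (a * w)) with hg
  have hgm : Measurable g := by fun_prop
  calc ∫⁻ ω, S.indicator 1 (Y ω) * ENNReal.ofReal (Real.exp (a * X ω - a ^ 2 * σ2 / 2)) ∂P
      = ∫⁻ ω, ENNReal.ofReal (Real.exp (-(a ^ 2 * σ2 / 2)))
          * (g (X ω - r * Y ω) * f (Y ω)) ∂P := by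
        refine lintegral_congr fun ω => ?_
        simp only [hf, hg]
        have : Real.exp (a * X ω - a ^ 2 * σ2 / 2) = Real.exp (-(a ^ 2 * σ2 / 2))
            * (Real.exp (a * (X ω - r * Y ω)) * Real.exp (a * r * Y ω)) := by
          rw [← Real.exp_add, ← Real.exp_add]; congr 1; ring
        rw [this, ENNReal.ofReal_mul (Real.exp_pos _).le, ENNReal.ofReal_mul (Real.exp_pos _).le]
        ring
    _ = ENNReal.ofReal (Real.exp (-(a ^ 2 * σ2 / 2)))
          * ((∫⁻ ω, g (X ω - r * Y ω) ∂P) * ∫⁻ ω, f (Y ω) ∂P) := by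
        rw [lintegral_const_mul' _ _ ENNReal.ofReal_ne_top]
        congr 1
        exact lintegral_mul_eq_lintegral_mul_lintegral_of_indepFun''
          (hgm.comp_aemeasurable (hXm.sub (hYm.const_mul r))) (hfm.comp_aemeasurable hYm)
          (hind.comp hgm hfm)
    -- The residual has variance `σ2 - r² τ2`, so after normalization its exponential moment leaves
    -- the gain `-(a r)² τ2 / 2`. On `|Y| < 2` the remaining factor `exp (a r Y)` costs at most `exp
    -- (2 |a r|)`.
    _ ≤ ENNReal.ofReal (Real.exp (-(a ^ 2 * σ2 / 2)))
          * (ENNReal.ofReal (Real.exp ((σ2 - r ^ 2 * τ2) * a ^ 2 / 2))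
            * (P {ω | |Y ω| < 2} * ENNReal.ofReal (Real.exp (2 * |a * r|)))) := by
        gcongr
        · rw [lintegral_exp_mul_of_centered hWY.fst hW0, hWW]
        · calc ∫⁻ ω, f (Y ω) ∂P
              ≤ ∫⁻ ω, S.indicator 1 (Y ω) * ENNReal.ofReal (Real.exp (2 * |a * r|)) ∂P := by
                refine lintegral_mono fun ω => ?_
                simp only [hf]
                by_cases hy : Y ω ∈ S
                · refine mul_le_mul_right (ENNReal.ofReal_le_ofReal (Real.exp_le_exp.mpr ?_)) _
                  calc a * r * Y ω ≤ |a * r * Y ω| := le_abs_self _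
                    _ = |Y ω| * |a * r| := by rw [abs_mul, mul_comm]
                    _ ≤ 2 * |a * r| := by
                      gcongr
                      exact (show |Y ω| < 2 from hy).le
                · simp [hy]
            _ = P {ω | |Y ω| < 2} * ENNReal.ofReal (Real.exp (2 * |a * r|)) := by
                rw [lintegral_mul_const' _ _ ENNReal.ofReal_ne_top]
                congr 1
                have : (fun ω => S.indicator (1 : ℝ → ENNReal) (Y ω))
                    = (Y ⁻¹' S).indicator 1 := by
                  ext ω; simp [Set.indicator]
                rw [this, lintegral_indicator_one₀ (hYm.nullMeasurable hSm)]
                rfl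
    _ ≤ ENNReal.ofReal (Real.exp (-(a ^ 2 * σ2 / 2)))
          * (ENNReal.ofReal (Real.exp ((σ2 - r ^ 2 * τ2) * a ^ 2 / 2))
            * (min 1 (ENNReal.ofReal (2 / √τ2)) * ENNReal.ofReal (Real.exp (2 * |a * r|)))) := by
        gcongr
    _ = _ := by
        have h2 : Real.exp (2 * |a * c / τ2| - (a * c / τ2) ^ 2 * τ2 / 2)
            = Real.exp (-(a ^ 2 * σ2 / 2)) * (Real.exp ((σ2 - r ^ 2 * τ2) * a ^ 2 / 2)
              * Real.exp (2 * |a * r|)) := by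
          rw [← Real.exp_add, ← Real.exp_add, hr, mul_div_assoc]; congr 1; ring
        rw [h2, ENNReal.ofReal_mul (Real.exp_pos _).le, ENNReal.ofReal_mul (Real.exp_pos _).le]
        ring

lemma lintegral_fintype_prod_of_iIndepFun {ι : Type*} [Fintype ι] {X : ι → Ω → ENNReal}
    (hX : iIndepFun X P) (hm : ∀ i, AEMeasurable (X i) P) :
    ∫⁻ ω, ∏ i, X i ω ∂P = ∏ i, ∫⁻ ω, X i ω ∂P := by
  have h1 : ∀ i, X i =ᵐ[P] (hm i).mk (X i) := fun i => (hm i).ae_eq_mk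
  have h2 : iIndepFun (fun i => (hm i).mk (X i)) P := (iIndepFun_congr h1).mp hX
  have h3 : ∀ᵐ ω ∂P, ∀ i, X i ω = (hm i).mk (X i) ω := ae_all_iff.mpr h1
  rw [lintegral_congr_ae (g := fun ω => ∏ i, (hm i).mk (X i) ω)
    (by filter_upwards [h3] with ω hω; exact Finset.prod_congr rfl fun i _ => hω i),
    lintegral_prod_eq_prod_lintegral_of_indepFun _ _ h2 fun i => (hm i).measurable_mk]
  exact Finset.prod_congr rfl fun i _ => lintegral_congr_ae (h1 i).symm

/-- `E exp (X² / (4 V)) ≤ √2` for a centered Gaussian variable of variance at most `V`. -/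
lemma lintegral_exp_sq_le {v : ℝ≥0} {V : ℝ} (hv : v ≠ 0) (hvV : v ≤ V) :
    ∫⁻ x, ENNReal.ofReal (Real.exp (x ^ 2 / (4 * V))) ∂(gaussianReal 0 v)
      ≤ ENNReal.ofReal (√2) := by
  have hv' : (0 : ℝ) < v := by positivity
  have hV : 0 < V := hv'.trans_le hvV
  rw [gaussianReal_of_var_ne_zero _ hv, lintegral_withDensity_eq_lintegral_mul₀
    (measurable_gaussianPDF _ _).aemeasurable (by fun_prop)]
  calc ∫⁻ x, (gaussianPDF 0 v * fun x => ENNReal.ofReal (Real.exp (x ^ 2 / (4 * V)))) x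
      ≤ ∫⁻ x : ℝ, ENNReal.ofReal
          ((√(2 * Real.pi * v))⁻¹ * Real.exp (-(1 / (4 * v)) * x ^ 2)) := by
        refine lintegral_mono fun x => ?_
        simp only [Pi.mul_apply, gaussianPDF, gaussianPDFReal_def]
        rw [← ENNReal.ofReal_mul (by positivity)]
        refine ENNReal.ofReal_le_ofReal ?_
        rw [mul_assoc, ← Real.exp_add]
        gcongr
        -- Half of the Gaussian exponent `x² / (2v)` is cancelled. What remains is the exponent of
        -- variance `2v`, whose total mass is `√2` relative to the old normalization.
        have h1 : x ^ 2 / (4 * V) ≤ x ^ 2 / (4 * v) := by gcongr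
        have h2 : -(x - 0) ^ 2 / (2 * v) = -(2 * (x ^ 2 / (4 * v))) := by
          rw [sub_zero]; field_simp; ring
        have h3 : -(1 / (4 * (v : ℝ))) * x ^ 2 = -(x ^ 2 / (4 * v)) := by field_simp
        rw [h2, h3]; linarith
    _ = ENNReal.ofReal (√2) := by
        have hb : 0 < 1 / (4 * (v : ℝ)) := by positivity
        rw [← ofReal_integral_eq_lintegral_ofReal ((integrable_exp_neg_mul_sq hb).const_mul _)
          (ae_of_all _ fun _ => by positivity), integral_const_mul, integral_gaussian]
        congr 1
        rw [show Real.pi / (1 / (4 * (v : ℝ))) = 2 * (2 * Real.pi * v) by field_simp; norm_num,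
          Real.sqrt_mul (by norm_num : (0 : ℝ) ≤ 2)]
        have : 0 < √(2 * Real.pi * v) := by positivity
        rw [mul_comm, mul_assoc, mul_inv_cancel₀ this.ne', mul_one]

end Gaussian

/-! ### First-order exponential moments of centered Gaussian variables. -/

section Gaussian

variable {Ω : Type*} [MeasurableSpace Ω] {P : Measure Ω}

lemma integrable_exp_mul_of_centered {X : Ω → ℝ} (hX : HasGaussianLaw X P)
    (h0 : ∫ ω, X ω ∂P = 0) (a : ℝ) : Integrable (fun ω => Real.exp (a * X ω)) P := by
  have h := integrable_exp_mul_gaussianReal (μ := 0) (v := (∫ ω, X ω * X ω ∂P).toNNReal) a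
  rw [← HasGaussianLaw.map_eq_of_centered hX h0] at h
  exact h.comp_aemeasurable hX.aemeasurable

lemma integral_exp_mul_of_centered {X : Ω → ℝ} (hX : HasGaussianLaw X P)
    (h0 : ∫ ω, X ω ∂P = 0) (a : ℝ) :
    ∫ ω, Real.exp (a * X ω) ∂P = Real.exp ((∫ ω, X ω * X ω ∂P) * a ^ 2 / 2) := by
  rw [integral_eq_lintegral_of_nonneg_ae (ae_of_all _ fun _ => (Real.exp_pos _).le)
    (integrable_exp_mul_of_centered hX h0 a).1, lintegral_exp_mul_of_centered hX h0,
    ENNReal.toReal_ofReal (Real.exp_pos _).le]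

lemma mem_interior_integrableExpSet_of_centered {X : Ω → ℝ} (hX : HasGaussianLaw X P)
    (h0 : ∫ ω, X ω ∂P = 0) (a : ℝ) : a ∈ interior (integrableExpSet X P) := by
  have : integrableExpSet X P = Set.univ :=
    Set.eq_univ_of_forall fun a => integrable_exp_mul_of_centered hX h0 a
  simp [this]

lemma integrable_mul_exp_mul_of_centered {X : Ω → ℝ} (hX : HasGaussianLaw X P)
    (h0 : ∫ ω, X ω ∂P = 0) (a : ℝ) : Integrable (fun ω => X ω * Real.exp (a * X ω)) P := by
  have := integrable_pow_mul_exp_of_mem_interior_integrableExpSet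
    (mem_interior_integrableExpSet_of_centered hX h0 a) 1
  simpa using this

lemma integral_mul_exp_mul_of_centered {X : Ω → ℝ} (hX : HasGaussianLaw X P)
    (h0 : ∫ ω, X ω ∂P = 0) (a : ℝ) :
    ∫ ω, X ω * Real.exp (a * X ω) ∂P
      = (∫ ω, X ω * X ω ∂P) * a * Real.exp ((∫ ω, X ω * X ω ∂P) * a ^ 2 / 2) := by
  rw [← deriv_mgf (mem_interior_integrableExpSet_of_centered hX h0 a)]
  have : mgf X P = fun a => Real.exp ((∫ ω, X ω * X ω ∂P) * a ^ 2 / 2) := by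
    ext a; exact integral_exp_mul_of_centered hX h0 a
  rw [this]
  have h : HasDerivAt (fun a : ℝ => Real.exp ((∫ ω, X ω * X ω ∂P) * a ^ 2 / 2))
      (Real.exp ((∫ ω, X ω * X ω ∂P) * a ^ 2 / 2)
        * ((∫ ω, X ω * X ω ∂P) * (2 * a) / 2)) a := by
    have := (((hasDerivAt_pow 2 a).const_mul (∫ ω, X ω * X ω ∂P)).div_const 2).exp
    simpa using this
  rw [h.deriv]; ring

end Gaussian

/-! ### Drift induced by conditioning on the endpoint. -/

section Covariance

/-- Lower bound for `Cov (B_T, B_t - B_s)`. -/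
lemma mul_le_endpoint_covariance {H T s t : ℝ} (hH0 : 0 < H) (hH1 : H < 1) (hs : 0 ≤ s)
    (hst : s ≤ t) (htT : t ≤ T) :
    H * T ^ (2 * H - 1) * (t - s) ≤
      (1 / 2) * (t ^ (2 * H) + T ^ (2 * H) - (T - t) ^ (2 * H))
        - (1 / 2) * (s ^ (2 * H) + T ^ (2 * H) - (T - s) ^ (2 * H)) := by
  have hH : 0 < 2 * H := by linarith
  rcases hst.eq_or_lt with rfl | hst'
  · simp
  have hT : 0 < T := hs.trans_lt (hst'.trans_le htT)
  have key := Convex.mul_sub_le_image_sub_of_le_deriv (D := Set.Icc 0 T) (convex_Icc 0 T)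
    (f := fun x => (1 / 2) * (x ^ (2 * H) + T ^ (2 * H) - (T - x) ^ (2 * H)))
    (C := H * T ^ (2 * H - 1))
    (by
      refine Continuous.continuousOn ?_
      have h1 := Real.continuous_rpow_const hH.le
      exact continuous_const.mul ((h1.add continuous_const).sub
        (h1.comp (continuous_const.sub continuous_id))))
  have hd : ∀ x ∈ interior (Set.Icc 0 T), HasDerivAt
      (fun x => (1 / 2) * (x ^ (2 * H) + T ^ (2 * H) - (T - x) ^ (2 * H)))
      (H * (x ^ (2 * H - 1) + (T - x) ^ (2 * H - 1))) x := by
    intro x hx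
    rw [interior_Icc] at hx
    have h1 := Real.hasDerivAt_rpow_const (x := x) (p := 2 * H) (Or.inl hx.1.ne')
    have h2 := Real.hasDerivAt_rpow_const (x := T - x) (p := 2 * H)
      (Or.inl (sub_pos.mpr hx.2).ne')
    have h3 := h2.comp x ((hasDerivAt_id x).const_sub T)
    have h4 := ((h1.add_const (T ^ (2 * H))).sub h3).const_mul (1 / 2)
    refine h4.congr_deriv ?_
    ring
  refine key (fun x hx => (hd x hx).differentiableAt.differentiableWithinAt) ?_ s
    ⟨hs, hst.trans htT⟩ t ⟨hs.trans hst, htT⟩ hst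
  intro x hx
  rw [(hd x hx).deriv]
  rw [interior_Icc] at hx
  have hx1 : 0 < x := hx.1
  have hx2 : 0 < T - x := sub_pos.mpr hx.2
  refine mul_le_mul_of_nonneg_left ?_ hH0.le
  -- The derivative must dominate `H T^{2H-1}`. For `2H ≤ 1` the power is nonincreasing, so the term
  -- in `x ≤ T` suffices; for `2H ≥ 1` the power `2H - 1 ∈ [0, 1]` is subadditive and both terms are
  -- needed.
  rcases le_total (2 * H) 1 with h | h
  · have h1 : T ^ (2 * H - 1) ≤ x ^ (2 * H - 1) :=
      Real.rpow_le_rpow_of_nonpos hx1 hx.2.le (by linarith)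
    have h2 : 0 ≤ (T - x) ^ (2 * H - 1) := by positivity
    linarith
  · have := Real.rpow_add_le_add_rpow hx1.le hx2.le (show 0 ≤ 2 * H - 1 by linarith)
      (show 2 * H - 1 ≤ 1 by linarith)
    simpa using this

end Covariance

section Tilt

variable {Ω : Type*} {d : ℕ} {H : ℝ} {B : ℝ → Ω → EuclideanSpace ℝ (Fin d)}

/-- The density of the law of `B` shifted by `a` times the covariance function of `B_T`. -/
noncomputable def tiltDensity (H : ℝ) (B : ℝ → Ω → EuclideanSpace ℝ (Fin d)) (i : Fin d) (a T : ℝ) (ω : Ω) : ℝ :=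
  Real.exp (a * B T ω i - a ^ 2 * T ^ (2 * H) / 2)

lemma tiltDensity_pos (i : Fin d) (a T : ℝ) (ω : Ω) : 0 < tiltDensity H B i a T ω :=
  Real.exp_pos _

lemma tiltDensity_eq (i : Fin d) (a T : ℝ) : tiltDensity H B i a T =
    fun ω => Real.exp (-(a ^ 2 * T ^ (2 * H) / 2)) * Real.exp (a * B T ω i) := by
  ext ω; rw [tiltDensity, ← Real.exp_add]; congr 1; ring

end Tilt

/-! ### Fractional Brownian motion under the tilted law. -/

section FBM

variable {Ω : Type*} [MeasurableSpace Ω] {P : Measure Ω} {d : ℕ} {H : ℝ}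
  {B : ℝ → Ω → EuclideanSpace ℝ (Fin d)}

namespace IsFBM

lemma hasGaussianLaw_eval (hB : IsFBM H B P) (i : Fin d) {t : ℝ} (ht : 0 ≤ t) :
    HasGaussianLaw (fun ω => B t ω i) P :=
  (hB.gaussian i).hasGaussianLaw_eval ⟨t, ht⟩

lemma hasGaussianLaw_sub (hB : IsFBM H B P) (i : Fin d) {s t r : ℝ} (hs : 0 ≤ s) (ht : 0 ≤ t)
    (hr : 0 ≤ r) : HasGaussianLaw (fun ω => (B r ω i, B t ω i - B s ω i)) P := by
  lift r to ℝ≥0 using hr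
  lift s to ℝ≥0 using hs
  lift t to ℝ≥0 using ht
  let π (u : ({r, s, t} : Finset ℝ≥0)) : (({r, s, t} : Finset ℝ≥0) → ℝ) →L[ℝ] ℝ :=
    ContinuousLinearMap.proj u
  exact ((hB.gaussian i).hasGaussianLaw {r, s, t}).map_fun
    ((π ⟨r, by simp⟩).prod (π ⟨t, by simp⟩ - π ⟨s, by simp⟩))

lemma integral_sub_eq_zero (hB : IsFBM H B P) (i : Fin d) {s t : ℝ} (hs : 0 ≤ s) (ht : 0 ≤ t) :
    ∫ ω, (B t ω i - B s ω i) ∂P = 0 := by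
  rw [integral_sub (hB.hasGaussianLaw_eval i ht).integrable
    (hB.hasGaussianLaw_eval i hs).integrable, hB.centered i t ht, hB.centered i s hs, sub_zero]

lemma integrable_mul (hB : IsFBM H B P) (i : Fin d) {s t : ℝ} (hs : 0 ≤ s) (ht : 0 ≤ t) :
    Integrable (fun ω => B s ω i * B t ω i) P :=
  (hB.hasGaussianLaw_eval i hs).memLp_two.integrable_mul (hB.hasGaussianLaw_eval i ht).memLp_two

lemma integral_mul_self (hB : IsFBM H B P) (hH : 0 < H) (i : Fin d) {t : ℝ} (ht : 0 ≤ t) :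
    ∫ ω, B t ω i * B t ω i ∂P = t ^ (2 * H) := by
  rw [hB.covariance i t t ht ht, sub_self, abs_zero, Real.zero_rpow (by positivity)]
  ring

lemma integral_mul_sub (hB : IsFBM H B P) (i : Fin d) {s t T : ℝ} (hs : 0 ≤ s) (ht : t ≤ T)
    (hst : s ≤ t) :
    ∫ ω, B T ω i * (B t ω i - B s ω i) ∂P =
      (1 / 2) * (t ^ (2 * H) + T ^ (2 * H) - (T - t) ^ (2 * H))
        - (1 / 2) * (s ^ (2 * H) + T ^ (2 * H) - (T - s) ^ (2 * H)) := by
  have ht0 := hs.trans hst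
  have hT0 := ht0.trans ht
  simp_rw [mul_sub]
  rw [integral_sub (hB.integrable_mul i hT0 ht0) (hB.integrable_mul i hT0 hs),
    hB.covariance i T t hT0 ht0, hB.covariance i T s hT0 hs, abs_sub_comm t T, abs_sub_comm s T,
    abs_of_nonneg (sub_nonneg.mpr ht), abs_of_nonneg (sub_nonneg.mpr (hst.trans ht))]
  ring

lemma integral_sub_mul_sub (hB : IsFBM H B P) (hH : 0 < H) (i : Fin d) {s t : ℝ} (hs : 0 ≤ s)
    (hst : s ≤ t) :
    ∫ ω, (B t ω i - B s ω i) * (B t ω i - B s ω i) ∂P = (t - s) ^ (2 * H) := by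
  have ht := hs.trans hst
  have h1 := hB.integrable_mul i ht ht
  have h2 := hB.integrable_mul i ht hs
  have h3 := hB.integrable_mul i hs hs
  have : (fun ω => (B t ω i - B s ω i) * (B t ω i - B s ω i)) =
      fun ω => (B t ω i * B t ω i - 2 * (B t ω i * B s ω i)) + B s ω i * B s ω i := by
    ext; ring
  have h4 : Integrable (fun ω => B t ω i * B t ω i - 2 * (B t ω i * B s ω i)) P :=
    h1.sub (h2.const_mul 2)
  rw [this, integral_add h4 h3, integral_sub h1 (h2.const_mul 2),
    integral_const_mul, hB.integral_mul_self hH i ht, hB.integral_mul_self hH i hs,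
    hB.covariance i t s ht hs, abs_sub_comm, abs_of_nonneg (sub_nonneg.mpr hst)]
  ring

lemma integrable_tiltDensity (hB : IsFBM H B P) (i : Fin d) (a : ℝ) {T : ℝ} (hT : 0 ≤ T) :
    Integrable (tiltDensity H B i a T) P := by
  rw [tiltDensity_eq]
  exact (integrable_exp_mul_of_centered (hB.hasGaussianLaw_eval i hT)
    (hB.centered i T hT) a).const_mul _

lemma integral_tiltDensity (hB : IsFBM H B P) (hH : 0 < H) (i : Fin d) (a : ℝ) {T : ℝ}
    (hT : 0 ≤ T) : ∫ ω, tiltDensity H B i a T ω ∂P = 1 := by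
  rw [tiltDensity_eq, integral_const_mul, integral_exp_mul_of_centered
    (hB.hasGaussianLaw_eval i hT) (hB.centered i T hT), hB.integral_mul_self hH i hT,
    ← Real.exp_add]
  simp [mul_comm]

lemma integrable_mul_tiltDensity (hB : IsFBM H B P) (i : Fin d) (a : ℝ) {T : ℝ} (hT : 0 ≤ T) :
    Integrable (fun ω => B T ω i * tiltDensity H B i a T ω) P := by
  rw [tiltDensity_eq]
  refine ((integrable_mul_exp_mul_of_centered (hB.hasGaussianLaw_eval i hT)
    (hB.centered i T hT) a).const_mul (Real.exp (-(a ^ 2 * T ^ (2 * H) / 2)))).congr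
    (ae_of_all _ fun ω => ?_)
  ring

lemma integral_mul_tiltDensity (hB : IsFBM H B P) (hH : 0 < H) (i : Fin d) (a : ℝ) {T : ℝ}
    (hT : 0 ≤ T) : ∫ ω, B T ω i * tiltDensity H B i a T ω ∂P = a * T ^ (2 * H) := by
  have : (fun ω => B T ω i * tiltDensity H B i a T ω) = fun ω =>
      Real.exp (-(a ^ 2 * T ^ (2 * H) / 2)) * (B T ω i * Real.exp (a * B T ω i)) := by
    rw [tiltDensity_eq]; ext; ring
  rw [this, integral_const_mul, integral_mul_exp_mul_of_centered (hB.hasGaussianLaw_eval i hT)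
    (hB.centered i T hT), hB.integral_mul_self hH i hT, mul_left_comm, ← Real.exp_add]
  simp [mul_comm]

lemma lintegral_tiltDensity (hB : IsFBM H B P) (hH : 0 < H) (i : Fin d) (a : ℝ) {T : ℝ}
    (hT : 0 ≤ T) : ∫⁻ ω, ENNReal.ofReal (tiltDensity H B i a T ω) ∂P = 1 := by
  rw [← ofReal_integral_eq_lintegral_ofReal (hB.integrable_tiltDensity i a hT)
    (ae_of_all _ fun ω => (tiltDensity_pos i a T ω).le), hB.integral_tiltDensity hH i a hT,
    ENNReal.ofReal_one]

/-- Tilted probability that an increment is small. -/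
lemma setLIntegral_tiltDensity_le (hB : IsFBM H B P) (hH0 : 0 < H) (i₀ : Fin d)
    {a s t T : ℝ} (hs : 0 ≤ s) (hst : s < t) (htT : t ≤ T) {c : ℝ}
    (hc : c = (1 / 2) * (t ^ (2 * H) + T ^ (2 * H) - (T - t) ^ (2 * H))
        - (1 / 2) * (s ^ (2 * H) + T ^ (2 * H) - (T - s) ^ (2 * H))) :
    ∫⁻ ω, Set.indicator {x | ‖x‖ < 2} 1 (B t ω - B s ω)
        * ENNReal.ofReal (tiltDensity H B i₀ a T ω) ∂P
      ≤ (min 1 (ENNReal.ofReal (2 / √((t - s) ^ (2 * H))))) ^ d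
        * ENNReal.ofReal (Real.exp (2 * |a * c / (t - s) ^ (2 * H)|
          - (a * c / (t - s) ^ (2 * H)) ^ 2 * (t - s) ^ (2 * H) / 2)) := by
  classical
  have ht := hs.trans hst.le
  have hT := ht.trans htT
  have hτ : 0 < (t - s) ^ (2 * H) := Real.rpow_pos_of_pos (sub_pos.mpr hst) _
  set S : Set ℝ := {y : ℝ | |y| < 2} with hS
  have hSm : MeasurableSet S := measurableSet_lt (by fun_prop) (by fun_prop)
  -- Only coordinate `i₀` is tilted. Intensity zero elsewhere makes the density a product over all
  -- coordinates, so that independence applies uniformly.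
  let α : Fin d → ℝ := fun i => if i = i₀ then a else 0
  let G : Fin d → (ℝ≥0 → ℝ) → ENNReal := fun i f =>
    S.indicator 1 (f ⟨t, ht⟩ - f ⟨s, hs⟩)
      * ENNReal.ofReal (Real.exp (α i * f ⟨T, hT⟩ - α i ^ 2 * T ^ (2 * H) / 2))
  have hG : ∀ i, Measurable (G i) := fun i =>
    ((measurable_one.indicator hSm).comp
      ((measurable_pi_apply (⟨t, ht⟩ : ℝ≥0)).sub (measurable_pi_apply (⟨s, hs⟩ : ℝ≥0)))).mul
      (ENNReal.measurable_ofReal.comp (Real.measurable_exp.comp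
        (((measurable_pi_apply _).const_mul _).sub_const _)))
  have hGm : ∀ i, AEMeasurable (fun ω => G i (fun r : ℝ≥0 => B r ω i)) P := by
    intro i
    have h1 := (hB.hasGaussianLaw_eval i ht).aemeasurable
    have h2 := (hB.hasGaussianLaw_eval i hs).aemeasurable
    have h3 := (hB.hasGaussianLaw_eval i hT).aemeasurable
    exact ((measurable_one.indicator hSm).comp_aemeasurable (h1.sub h2)).mul
      (ENNReal.measurable_ofReal.comp_aemeasurable (Real.measurable_exp.comp_aemeasurable
        ((h3.const_mul _).sub_const _)))
  have hind : iIndepFun (fun i ω => G i (fun r : ℝ≥0 => B r ω i)) P :=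
    hB.indep.comp G hG
  calc ∫⁻ ω, Set.indicator {x | ‖x‖ < 2} 1 (B t ω - B s ω)
        * ENNReal.ofReal (tiltDensity H B i₀ a T ω) ∂P
      ≤ ∫⁻ ω, ∏ i, G i (fun r : ℝ≥0 => B r ω i) ∂P := by
        refine lintegral_mono fun ω => ?_
        simp only [G]
        rw [Finset.prod_mul_distrib]
        have h1 : ∏ i, ENNReal.ofReal (Real.exp (α i * B T ω i - α i ^ 2 * T ^ (2 * H) / 2))
            = ENNReal.ofReal (tiltDensity H B i₀ a T ω) := by
          rw [Finset.prod_eq_single i₀]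
          · simp [α, tiltDensity]
          · intro i _ hi; simp [α, hi]
          · simp
        refine mul_le_mul' ?_ h1.symm.le
        -- The ball is enlarged to the cube containing it, whose indicator factors over coordinates.
        by_cases h : ‖B t ω - B s ω‖ < 2
        · have h2 : ∀ i, B t ω i - B s ω i ∈ S := fun i => by
            have := PiLp.norm_apply_le (B t ω - B s ω) i
            simp only [PiLp.sub_apply, Real.norm_eq_abs] at this
            exact this.trans_lt h
          have h3 : ∀ i, S.indicator (1 : ℝ → ENNReal) (B t ω i - B s ω i) = 1 := fun i => by
            simp [h2 i]
          have h4 : ∏ i, S.indicator (1 : ℝ → ENNReal) (B t ω i - B s ω i) = 1 :=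
            Finset.prod_eq_one fun i _ => h3 i
          refine le_of_le_of_eq ?_ h4.symm
          exact Set.indicator_le_self' (fun _ _ => zero_le) _
        · simp [h]
    _ = ∏ i, ∫⁻ ω, G i (fun r : ℝ≥0 => B r ω i) ∂P :=
        lintegral_fintype_prod_of_iIndepFun hind hGm
    _ ≤ ∏ i, (min 1 (ENNReal.ofReal (2 / √((t - s) ^ (2 * H))))
          * ENNReal.ofReal (Real.exp (2 * |α i * c / (t - s) ^ (2 * H)|
          - (α i * c / (t - s) ^ (2 * H)) ^ 2 * (t - s) ^ (2 * H) / 2))) := by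
        refine Finset.prod_le_prod' fun i _ => ?_
        exact lintegral_indicator_mul_exp_le (hB.hasGaussianLaw_sub i hs ht hT)
          (hB.centered i T hT) (hB.integral_sub_eq_zero i hs ht) (hB.integral_mul_self hH0 i hT)
          ((hB.integral_mul_sub i hs htT hst.le).trans hc.symm)
          (hB.integral_sub_mul_sub hH0 i hs hst.le) hτ
    _ = _ := by
        rw [Finset.prod_mul_distrib, Finset.prod_const, Finset.card_univ, Fintype.card_fin]
        congr 1
        rw [Finset.prod_eq_single i₀]
        · simp [α]
        · intro i _ hi; simp [α, hi]
        · simp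

/-- The exponential of the squared norm factors over the independent coordinates. Scaling by `T`
instead of `t` makes the bound uniform in time, ready to be integrated over `[0, T]`. -/
lemma lintegral_exp_norm_sq_le (hB : IsFBM H B P) (hH0 : 0 < H) {t T : ℝ} (ht : 0 < t)
    (htT : t ≤ T) :
    ∫⁻ ω, ENNReal.ofReal (Real.exp (‖B t ω‖ ^ 2 / (4 * T ^ (2 * H)))) ∂P
      ≤ ENNReal.ofReal (√2) ^ d := by
  let G : (ℝ≥0 → ℝ) → ENNReal := fun f =>
    ENNReal.ofReal (Real.exp (f ⟨t, ht.le⟩ ^ 2 / (4 * T ^ (2 * H))))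
  have hG : Measurable G :=
    ENNReal.measurable_ofReal.comp (Real.measurable_exp.comp
      (((measurable_pi_apply _).pow_const 2).div_const _))
  have hm : ∀ i, AEMeasurable (fun ω => B t ω i) P := fun i =>
    (hB.hasGaussianLaw_eval i ht.le).aemeasurable
  have hGm : ∀ i, AEMeasurable (fun ω => G (fun r : ℝ≥0 => B r ω i)) P := fun i =>
    ENNReal.measurable_ofReal.comp_aemeasurable (Real.measurable_exp.comp_aemeasurable
      (((hm i).pow_const 2).div_const _))
  calc ∫⁻ ω, ENNReal.ofReal (Real.exp (‖B t ω‖ ^ 2 / (4 * T ^ (2 * H)))) ∂P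
      = ∫⁻ ω, ∏ i, G (fun r : ℝ≥0 => B r ω i) ∂P := by
        refine lintegral_congr fun ω => ?_
        simp only [G]
        rw [← ENNReal.ofReal_prod_of_nonneg fun i _ => (Real.exp_pos _).le, ← Real.exp_sum,
          ← Finset.sum_div, EuclideanSpace.real_norm_sq_eq]
        rfl
    _ = ∏ i, ∫⁻ ω, G (fun r : ℝ≥0 => B r ω i) ∂P :=
        lintegral_fintype_prod_of_iIndepFun (hB.indep.comp (fun _ => G) fun _ => hG) hGm
    _ ≤ ∏ _i : Fin d, ENNReal.ofReal (√2) := by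
        refine Finset.prod_le_prod' fun i _ => ?_
        have h := HasGaussianLaw.map_eq_of_centered (hB.hasGaussianLaw_eval i ht.le)
          (hB.centered i t ht.le)
        rw [hB.integral_mul_self hH0 i ht.le] at h
        have hp : 0 < t ^ (2 * H) := by positivity
        have h2 := lintegral_exp_sq_le (v := (t ^ (2 * H)).toNNReal) (V := T ^ (2 * H))
          (by simpa using hp) (by
            rw [Real.coe_toNNReal _ hp.le]
            exact Real.rpow_le_rpow ht.le htT (by positivity))
        rw [← h, lintegral_map' (by fun_prop) (hm i)] at h2
        exact h2
    _ = _ := by simp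

end IsFBM

end FBM

/-! ### Deterministic estimates for a single path. -/

section Path

variable {d : ℕ} {b b' : ℝ → EuclideanSpace ℝ (Fin d)} {T : ℝ}

/-- The time spent in a unit ball, with values in `[0, ∞]`. -/
noncomputable def occupationMeasure (b : ℝ → EuclideanSpace ℝ (Fin d)) (T : ℝ)
    (y : EuclideanSpace ℝ (Fin d)) : ENNReal :=
  volume {t : ℝ | t ∈ Set.Icc 0 T ∧ b t ∈ Metric.ball y 1}

/-- The energy `∫ L_T(z)² dz`, with values in `[0, ∞]`. -/
noncomputable def selfEnergy (b : ℝ → EuclideanSpace ℝ (Fin d)) (T : ℝ) : ENNReal :=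
  ∫⁻ z, occupationMeasure b T z ^ 2

lemma occupationTime_eq (y : EuclideanSpace ℝ (Fin d)) :
    occupationTime b T y = (occupationMeasure b T y).toReal := rfl

lemma occupationMeasure_lt_top (y : EuclideanSpace ℝ (Fin d)) : occupationMeasure b T y < ⊤ :=
  (measure_mono fun _ ht => ht.1).trans_lt (measure_Icc_lt_top (a := (0 : ℝ)) (b := T))

lemma measurable_occupationMeasure (hb : Measurable b) : Measurable (occupationMeasure b T) := by
  have hs : MeasurableSet {p : EuclideanSpace ℝ (Fin d) × ℝ |
      p.2 ∈ Set.Icc 0 T ∧ b p.2 ∈ Metric.ball p.1 1} := by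
    refine (measurable_snd measurableSet_Icc).inter ?_
    exact measurableSet_lt (f := fun p : EuclideanSpace ℝ (Fin d) × ℝ => dist (b p.2) p.1)
      (by fun_prop) measurable_const
  exact measurable_measure_prodMk_left hs

lemma integral_occupationTime_sq (hb : Measurable b) :
    ∫ z, occupationTime b T z ^ 2 = (selfEnergy b T).toReal := by
  simp_rw [occupationTime_eq, ← ENNReal.toReal_pow]
  exact integral_toReal ((measurable_occupationMeasure hb).pow_const 2).aemeasurable
    (ae_of_all _ fun z => ENNReal.pow_lt_top (occupationMeasure_lt_top z))

lemma penalty_eq (hb : Measurable b) (β : ℝ) :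
    penalty β b T = Real.exp (-β * (selfEnergy b T).toReal) := by
  rw [penalty, integral_occupationTime_sq hb]

lemma occupationMeasure_eq_setLIntegral (hb : Measurable b) (z : EuclideanSpace ℝ (Fin d)) :
    occupationMeasure b T z
      = ∫⁻ t in Set.Icc 0 T, (Metric.ball (b t) 1).indicator 1 z := by
  have hs : MeasurableSet (b ⁻¹' Metric.ball z 1) := hb Metric.isOpen_ball.measurableSet
  have h : (fun t => (Metric.ball (b t) 1).indicator (1 : EuclideanSpace ℝ (Fin d) → ENNReal) z)
      = (b ⁻¹' Metric.ball z 1).indicator 1 := by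
    ext t
    simp only [Set.indicator, Metric.mem_ball, Set.mem_preimage, dist_comm z (b t), Pi.one_apply]
  rw [h, lintegral_indicator_one hs, Measure.restrict_apply hs, occupationMeasure]
  congr 1
  ext t
  simp [and_comm]

lemma measurable_ball_indicator {α : Type*} [MeasurableSpace α]
    {f g : α → EuclideanSpace ℝ (Fin d)} (hf : Measurable f) (hg : Measurable g) :
    Measurable fun x => (Metric.ball (f x) 1).indicator (1 : EuclideanSpace ℝ (Fin d) → ENNReal) (g x) := by
  have hs : MeasurableSet {x | dist (g x) (f x) < 1} :=
    measurableSet_lt (by fun_prop) measurable_const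
  exact (measurable_one.indicator hs : Measurable ({x | dist (g x) (f x) < 1}.indicator
    (1 : α → ENNReal)))

/-- The square is a double integral in time; Tonelli then moves the space integral inside. This
turns the energy into an integral over pairs of times. -/
lemma lintegral_sq_lintegral {α γ : Type*} [MeasurableSpace α] [MeasurableSpace γ]
    {μ : Measure α} {ν : Measure γ} [SFinite μ] [SFinite ν] {φ : α → γ → ENNReal}
    (hφ : Measurable (Function.uncurry φ)) :
    ∫⁻ z, (∫⁻ s, φ z s ∂ν) ^ 2 ∂μ = ∫⁻ s, ∫⁻ t, ∫⁻ z, φ z s * φ z t ∂μ ∂ν ∂ν := by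
  have hφt : ∀ z, Measurable (φ z) := fun z => hφ.comp measurable_prodMk_left
  have hφz : ∀ t, Measurable fun z => φ z t := fun t => hφ.comp measurable_prodMk_right
  have h1 : ∀ z, (∫⁻ s, φ z s ∂ν) ^ 2 = ∫⁻ s, ∫⁻ t, φ z s * φ z t ∂ν ∂ν := by
    intro z
    simp_rw [lintegral_const_mul _ (hφt z)]
    rw [lintegral_mul_const _ (hφt z), sq]
  have hm3 : Measurable fun p : (α × γ) × γ => φ p.1.1 p.1.2 * φ p.1.1 p.2 :=
    (hφ.comp measurable_fst).mul
      (hφ.comp ((measurable_fst.comp measurable_fst).prodMk measurable_snd))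
  simp_rw [h1]
  rw [lintegral_lintegral_swap hm3.lintegral_prod_right'.aemeasurable]
  refine lintegral_congr fun s => ?_
  exact lintegral_lintegral_swap (((hφz s).comp measurable_fst).mul hφ).aemeasurable

/-- Two open unit balls meet only if their centres are at distance less than two, and their
intersection is no larger than one of them. -/
lemma lintegral_ball_mul_ball_le (x y : EuclideanSpace ℝ (Fin d)) :
    ∫⁻ z, (Metric.ball x 1).indicator 1 z * (Metric.ball y 1).indicator 1 z
      ≤ volume (Metric.ball (0 : EuclideanSpace ℝ (Fin d)) 1)
        * Set.indicator {x | ‖x‖ < 2} 1 (y - x) := by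
  by_cases h : ‖y - x‖ < 2
  · calc ∫⁻ z, (Metric.ball x 1).indicator 1 z * (Metric.ball y 1).indicator 1 z
        ≤ ∫⁻ z, (Metric.ball y 1).indicator 1 z := by
          refine lintegral_mono fun z => mul_le_of_le_one_left' ?_
          exact Set.indicator_le_self' (fun _ _ => zero_le) _
      _ = volume (Metric.ball y 1) := lintegral_indicator_one Metric.isOpen_ball.measurableSet
      _ = volume (Metric.ball (0 : EuclideanSpace ℝ (Fin d)) 1) :=
          Measure.addHaar_ball_center volume y 1
      _ ≤ _ := by simp [h]
  · refine (le_of_eq (lintegral_eq_zero_of_ae_eq_zero (ae_of_all _ fun z => ?_))).trans zero_le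
    by_cases h1 : z ∈ Metric.ball x 1
    · have h2 : z ∉ Metric.ball y 1 := fun h2 => h <| by
        rw [← dist_eq_norm]
        rw [Metric.mem_ball] at h1 h2
        linarith [dist_triangle_left y x z]
      simp [h2]
    · simp [h1]

lemma selfEnergy_le (hb : Measurable b) :
    selfEnergy b T ≤ volume (Metric.ball (0 : EuclideanSpace ℝ (Fin d)) 1)
      * ∫⁻ s in Set.Icc 0 T, ∫⁻ t in Set.Icc 0 T, Set.indicator {x | ‖x‖ < 2} 1 (b t - b s) := by
  rw [selfEnergy]
  simp_rw [occupationMeasure_eq_setLIntegral hb]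
  rw [lintegral_sq_lintegral (measurable_ball_indicator (hb.comp measurable_snd) measurable_fst),
    ← lintegral_const_mul' _ _ measure_ball_lt_top.ne]
  refine lintegral_mono fun s => ?_
  dsimp only
  rw [← lintegral_const_mul' _ _ measure_ball_lt_top.ne]
  exact lintegral_mono fun t => lintegral_ball_mul_ball_le _ _

lemma selfEnergy_lt_top (hb : Measurable b) : selfEnergy b T < ⊤ := by
  refine (selfEnergy_le hb).trans_lt (ENNReal.mul_lt_top measure_ball_lt_top ?_)
  calc ∫⁻ s in Set.Icc 0 T, ∫⁻ t in Set.Icc 0 T, Set.indicator {x | ‖x‖ < 2} 1 (b t - b s)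
      ≤ ∫⁻ _s in Set.Icc 0 T, ∫⁻ _t in Set.Icc 0 T, 1 := by
        refine lintegral_mono fun s => lintegral_mono fun t => ?_
        exact Set.indicator_le_self' (fun _ _ => zero_le) _
    _ < ⊤ := by
        simp only [lintegral_const, one_mul, Measure.restrict_apply_univ]
        exact ENNReal.mul_lt_top measure_Icc_lt_top measure_Icc_lt_top

lemma ae_restrict_Icc_of_Ici {p : ℝ → Prop} (h : ∀ᵐ t ∂(volume.restrict (Set.Ici 0)), p t) :
    ∀ᵐ t ∂(volume.restrict (Set.Icc 0 T)), p t :=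
  ae_mono (Measure.restrict_mono (fun _ h => h.1) le_rfl) h

/-- Occupation times ignore null sets of times, which allows the process to be replaced by a jointly
measurable version. -/
lemma penalty_congr (β : ℝ) (h : b =ᵐ[volume.restrict (Set.Ici 0)] b') :
    penalty β b T = penalty β b' T := by
  have h1 : occupationTime b T = occupationTime b' T := by
    ext y
    refine congrArg ENNReal.toReal (measure_congr ?_)
    have h2 := (ae_restrict_iff' measurableSet_Ici).mp h
    filter_upwards [h2] with t ht
    refine propext (and_congr_right fun hT => ?_)
    rw [ht hT.1]
  rw [penalty, penalty, h1]

lemma gyrationRadius_congr (hT : 0 ≤ T) (h : b =ᵐ[volume.restrict (Set.Ici 0)] b') :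
    gyrationRadius b T = gyrationRadius b' T := by
  have h2 : ∀ᵐ t ∂volume, t ∈ Set.uIoc 0 T → b t = b' t := by
    have h2 := (ae_restrict_iff' measurableSet_Ici).mp h
    filter_upwards [h2] with t ht hT'
    rw [Set.uIoc_of_le hT] at hT'
    exact ht hT'.1.le
  have h3 : timeMean b T = timeMean b' T := by
    rw [timeMean, timeMean, intervalIntegral.integral_congr_ae h2]
  rw [gyrationRadius, gyrationRadius, h3]
  congr 2
  refine intervalIntegral.integral_congr_ae ?_
  filter_upwards [h2] with t ht hT'
  rw [ht hT']

lemma gyrationRadius_nonneg : 0 ≤ gyrationRadius b T := Real.sqrt_nonneg _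

lemma gyrationRadius_sq (hT : 0 < T) :
    gyrationRadius b T ^ 2 = (1 / T) * ∫ t in Set.Icc 0 T, ‖b t - timeMean b T‖ ^ 2 := by
  rw [gyrationRadius, intervalIntegral.integral_of_le hT.le, ← integral_Icc_eq_integral_Ioc,
    Real.sq_sqrt (mul_nonneg (by positivity) (integral_nonneg fun _ => by positivity))]

lemma memLp_two_of_integrable_sq (hb : Measurable b)
    (hi : IntegrableOn (fun t => ‖b t‖ ^ 2) (Set.Icc 0 T)) :
    MemLp b 2 (volume.restrict (Set.Icc 0 T)) :=
  (memLp_two_iff_integrable_sq_norm hb.aestronglyMeasurable).mpr hi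

/-- Expanding the square around the time mean: the variance is the second moment minus the squared
norm of the mean. -/
lemma gyrationRadius_sq_le (hb : Measurable b) (hT : 0 < T)
    (hi : IntegrableOn (fun t => ‖b t‖ ^ 2) (Set.Icc 0 T)) :
    gyrationRadius b T ^ 2 ≤ (1 / T) * ∫ t in Set.Icc 0 T, ‖b t‖ ^ 2 := by
  have hL := memLp_two_of_integrable_sq hb hi
  have hbi : Integrable b (volume.restrict (Set.Icc 0 T)) := hL.integrable (by norm_num)
  rw [gyrationRadius_sq hT]
  refine mul_le_mul_of_nonneg_left ?_ (by positivity)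
  set m := timeMean b T with hm
  have hm' : ∫ t in Set.Icc 0 T, b t = T • m := by
    rw [hm, timeMean, intervalIntegral.integral_of_le hT.le, ← integral_Icc_eq_integral_Ioc,
      smul_smul, mul_one_div_cancel hT.ne', one_smul]
  have hin : Integrable (fun t => inner ℝ m (b t)) (volume.restrict (Set.Icc 0 T)) :=
    hbi.const_inner m
  have hexp : (fun t => ‖b t - m‖ ^ 2) = fun t => (‖b t‖ ^ 2 - 2 * inner ℝ m (b t)) + ‖m‖ ^ 2 := by
    ext t; rw [norm_sub_sq_real, real_inner_comm]
  have h1 : Integrable (fun t => ‖b t‖ ^ 2 - 2 * inner ℝ m (b t))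
      (volume.restrict (Set.Icc 0 T)) := Integrable.sub hi (hin.const_mul 2)
  rw [hexp, integral_add h1 (integrable_const _), integral_sub hi (hin.const_mul 2),
    integral_const_mul, integral_inner hbi, hm', inner_smul_right, real_inner_self_eq_norm_sq,
    integral_const]
  simp only [measureReal_restrict_apply_univ, Real.volume_real_Icc_of_le hT.le, smul_eq_mul,
    sub_zero]
  nlinarith [mul_nonneg hT.le (sq_nonneg ‖m‖)]

/-- Jensen's inequality for the exponential of the squared radius of gyration. -/
lemma mul_exp_gyrationRadius_sq_le (hb : Measurable b) (hT : 0 < T) {l : ℝ} (hl : 0 < l) :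
    ENNReal.ofReal (T * Real.exp (l * gyrationRadius b T ^ 2))
      ≤ ∫⁻ t in Set.Icc 0 T, ENNReal.ofReal (Real.exp (l * ‖b t‖ ^ 2)) := by
  set μ := volume.restrict (Set.Icc 0 T) with hμ
  by_cases hfin : ∫⁻ t in Set.Icc 0 T, ENNReal.ofReal (Real.exp (l * ‖b t‖ ^ 2)) = ⊤
  · rw [hfin]; exact le_top
  have hE : Integrable (fun t => Real.exp (l * ‖b t‖ ^ 2)) μ := by
    refine ⟨by fun_prop, ?_⟩
    rw [hasFiniteIntegral_iff_ofReal (ae_of_all _ fun _ => (Real.exp_pos _).le)]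
    exact Ne.lt_top hfin
  have hf : Integrable (fun t => l * ‖b t‖ ^ 2) μ := by
    refine hE.mono' (by fun_prop) (ae_of_all _ fun t => ?_)
    rw [Real.norm_of_nonneg (by positivity)]
    linarith [Real.add_one_le_exp (l * ‖b t‖ ^ 2)]
  have hi : IntegrableOn (fun t => ‖b t‖ ^ 2) (Set.Icc 0 T) := by
    refine (hf.const_mul l⁻¹).congr (ae_of_all _ fun t => ?_)
    field_simp
  rw [← ofReal_integral_eq_lintegral_ofReal hE (ae_of_all _ fun _ => (Real.exp_pos _).le)]
  refine ENNReal.ofReal_le_ofReal ?_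
  -- The time average of the exponent. Jensen's inequality is obtained by integrating the tangent
  -- line of `exp` at this point.
  set m := l * ((1 / T) * ∫ t, ‖b t‖ ^ 2 ∂μ) with hm
  have hRm : l * gyrationRadius b T ^ 2 ≤ m :=
    mul_le_mul_of_nonneg_left (gyrationRadius_sq_le hb hT hi) hl.le
  have hint : ∫ t, l * ‖b t‖ ^ 2 ∂μ = T * m := by
    rw [integral_const_mul, hm]; field_simp
  calc T * Real.exp (l * gyrationRadius b T ^ 2) ≤ T * Real.exp m := by gcongr
    _ = ∫ t, Real.exp m * (l * ‖b t‖ ^ 2 + (1 - m)) ∂μ := by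
        rw [integral_const_mul, integral_add hf (integrable_const _), hint, integral_const]
        simp only [hμ, measureReal_restrict_apply_univ, Real.volume_real_Icc_of_le hT.le,
          smul_eq_mul, sub_zero]
        ring
    _ ≤ ∫ t, Real.exp (l * ‖b t‖ ^ 2) ∂μ := by
        refine integral_mono ((hf.add (integrable_const _)).const_mul _) hE fun t => ?_
        have h1 : Real.exp (l * ‖b t‖ ^ 2) = Real.exp m * Real.exp (l * ‖b t‖ ^ 2 - m) := by
          rw [← Real.exp_add]; congr 1; ring
        dsimp only
        rw [h1]
        refine mul_le_mul_of_nonneg_left ?_ (Real.exp_pos _).le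
        linarith [Real.add_one_le_exp (l * ‖b t‖ ^ 2 - m)]

lemma volume_real_ball (x : EuclideanSpace ℝ (Fin d)) {r : ℝ} (hr : 0 < r) :
    volume.real (Metric.ball x r)
      = r ^ d * volume.real (Metric.ball (0 : EuclideanSpace ℝ (Fin d)) 1) := by
  rw [measureReal_def, measureReal_def, Measure.addHaar_ball_of_pos _ x hr, ENNReal.toReal_mul,
    finrank_euclideanSpace_fin, ENNReal.toReal_ofReal (by positivity)]

/-- A path with a small radius of gyration has a large energy. -/
lemma le_integral_occupationTime_sq (hb : Measurable b) (hT : 0 < T)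
    (hi : IntegrableOn (fun t => ‖b t‖ ^ 2) (Set.Icc 0 T)) {r : ℝ} (hr0 : 0 < r)
    (hr : gyrationRadius b T < r) :
    9 / 16 * volume.real (Metric.ball (0 : EuclideanSpace ℝ (Fin d)) 1) * T ^ 2 / (2 * r + 1) ^ d
      ≤ ∫ z, occupationTime b T z ^ 2 := by
  set K := volume.real (Metric.ball (0 : EuclideanSpace ℝ (Fin d)) 1) with hK
  have hK0 : 0 ≤ K := measureReal_nonneg
  set m := timeMean b T with hm
  set μ := volume.restrict (Set.Icc 0 T) with hμ
  set G : Set ℝ := {t | ‖b t - m‖ < 2 * r} with hG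
  have hGm : MeasurableSet G := measurableSet_lt (by fun_prop) measurable_const
  have hL := memLp_two_of_integrable_sq hb hi
  have hi' : Integrable (fun t => ‖b t - m‖ ^ 2) μ :=
    (memLp_two_iff_integrable_sq_norm (by fun_prop)).mp (hL.sub (memLp_const m))
  have hint : ∫ t, ‖b t - m‖ ^ 2 ∂μ ≤ T * r ^ 2 := by
    have h1 := gyrationRadius_sq (b := b) hT
    have h2 : gyrationRadius b T ^ 2 ≤ r ^ 2 := by
      have := gyrationRadius_nonneg (b := b) (T := T)
      gcongr
    rw [h1] at h2
    calc ∫ t, ‖b t - m‖ ^ 2 ∂μ = T * ((1 / T) * ∫ t, ‖b t - m‖ ^ 2 ∂μ) := by field_simp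
      _ ≤ T * r ^ 2 := by gcongr
  -- Chebyshev: at most a quarter of the time is spent at distance `2r` or more from the mean.
  have hGc : 4 * r ^ 2 * μ.real Gᶜ ≤ T * r ^ 2 := by
    refine le_trans ?_ hint
    have h1 := mul_meas_ge_le_integral_of_nonneg (μ := μ) (f := fun t => ‖b t - m‖ ^ 2)
      (ae_of_all _ fun t => by positivity) hi' (4 * r ^ 2)
    have h2 : {t | 4 * r ^ 2 ≤ ‖b t - m‖ ^ 2} = Gᶜ := by
      ext t
      simp only [hG, Set.mem_ofPred_eq, Set.mem_compl_iff, not_lt]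
      rw [show 4 * r ^ 2 = (2 * r) ^ 2 by ring,
        pow_le_pow_iff_left₀ (by positivity) (norm_nonneg _) two_ne_zero]
    rwa [h2] at h1
  have hGc' : μ.real Gᶜ ≤ T / 4 := by
    have : 0 < 4 * r ^ 2 := by positivity
    rw [← mul_le_mul_iff_right₀ this]
    linarith
  have hGr : 3 / 4 * T ≤ μ.real G := by
    have h1 := measureReal_add_measureReal_compl (μ := μ) hGm
    have h2 : μ.real Set.univ = T := by
      simp [hμ, Real.volume_real_Icc_of_le hT.le]
    linarith
  set A : Set (EuclideanSpace ℝ (Fin d)) := Metric.ball m (2 * r + 1) with hA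
  have hAv : volume.real A = (2 * r + 1) ^ d * K := volume_real_ball m (by positivity)
  have hAf : volume A ≠ ⊤ := measure_ball_lt_top.ne
  have hom := measurable_occupationMeasure (T := T) hb
  -- For times in `G` the whole unit ball around the path lies in `A`, so each such time contributes
  -- the full volume `K`.
  have hL1 : ENNReal.ofReal (K * μ.real G) ≤ ∫⁻ z in A, occupationMeasure b T z := by
    simp_rw [occupationMeasure_eq_setLIntegral hb]
    rw [lintegral_lintegral_swap (measurable_ball_indicator (hb.comp measurable_snd)
      measurable_fst).aemeasurable]
    calc ENNReal.ofReal (K * μ.real G)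
        = ∫⁻ t in G, volume (Metric.ball (0 : EuclideanSpace ℝ (Fin d)) 1) ∂μ := by
          rw [setLIntegral_const, ENNReal.ofReal_mul hK0, hK, measureReal_def, measureReal_def,
            ENNReal.ofReal_toReal measure_ball_lt_top.ne, ENNReal.ofReal_toReal (measure_ne_top _ _)]
      _ ≤ ∫⁻ t in G, (∫⁻ z in A, (Metric.ball (b t) 1).indicator 1 z) ∂μ := by
          refine setLIntegral_mono_ae' hGm (ae_of_all _ fun t ht => ?_)
          rw [lintegral_indicator_one Metric.isOpen_ball.measurableSet,
            Measure.restrict_apply Metric.isOpen_ball.measurableSet,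
            Set.inter_eq_self_of_subset_left, Measure.addHaar_ball_center volume (b t) 1]
          refine Metric.ball_subset_ball' ?_
          have : dist (b t) m < 2 * r := by rw [dist_eq_norm]; exact ht
          linarith
      _ ≤ _ := setLIntegral_le_lintegral _ _
  have hoT : ∀ z, occupationMeasure b T z ≤ ENNReal.ofReal T := fun z => by
    refine (measure_mono fun _ ht => ht.1).trans (le_of_eq (Real.volume_Icc (a := 0) (b := T))) |>.trans ?_
    rw [sub_zero]
  have hoi : IntegrableOn (occupationTime b T) A := by
    refine Measure.integrableOn_of_bounded (M := T) hAf
      hom.ennreal_toReal.aestronglyMeasurable (ae_of_all _ fun z => ?_)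
    rw [occupationTime_eq, Real.norm_of_nonneg ENNReal.toReal_nonneg]
    exact ENNReal.toReal_le_of_le_ofReal hT.le (hoT z)
  have hoi2 : Integrable (fun z => occupationTime b T z ^ 2) := by
    simp_rw [occupationTime_eq, ← ENNReal.toReal_pow]
    exact integrable_toReal_of_lintegral_ne_top (hom.pow_const 2).aemeasurable
      (selfEnergy_lt_top hb).ne
  have hL1' : K * μ.real G ≤ ∫ z in A, occupationTime b T z := by
    have h1 : ∫ z in A, occupationTime b T z = (∫⁻ z in A, occupationMeasure b T z).toReal :=
      integral_toReal hom.aemeasurable (ae_of_all _ fun z => occupationMeasure_lt_top z)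
    rw [h1]
    refine (ENNReal.ofReal_le_iff_le_toReal ?_).mp hL1
    refine ((lintegral_mono fun z => hoT z).trans_lt ?_).ne
    rw [setLIntegral_const]
    exact ENNReal.mul_lt_top ENNReal.ofReal_lt_top hAf.lt_top
  set q := (2 * r + 1) ^ d with hq
  have hq0 : 0 < q := by positivity
  -- Cauchy-Schwarz in linearized form, `L² ≥ 2 l L - l²`, with `l` the lower bound just obtained
  -- for the average of `L` over `A`. Squaring `3/4` produces the constant `9/16`.
  set l := (3 / 4 * T) / q with hl
  have hl0 : 0 ≤ l := by positivity
  calc 9 / 16 * K * T ^ 2 / q = 2 * l * (K * (3 / 4 * T)) - l ^ 2 * (q * K) := by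
        rw [hl]; field_simp; ring
    _ ≤ 2 * l * (∫ z in A, occupationTime b T z) - l ^ 2 * (q * K) := by
        have : K * (3 / 4 * T) ≤ ∫ z in A, occupationTime b T z :=
          (mul_le_mul_of_nonneg_left hGr hK0).trans hL1'
        gcongr
    _ = ∫ z in A, (2 * l * occupationTime b T z - l ^ 2) := by
        rw [integral_sub (hoi.const_mul _) (integrableOn_const hAf), integral_const_mul,
          setIntegral_const, smul_eq_mul, hAv]
        ring
    _ ≤ ∫ z in A, occupationTime b T z ^ 2 := by
        refine integral_mono ((hoi.const_mul _).sub (integrableOn_const hAf))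
          hoi2.integrableOn fun z => ?_
        dsimp only
        nlinarith [sq_nonneg (occupationTime b T z - l)]
    _ ≤ ∫ z, occupationTime b T z ^ 2 :=
        setIntegral_le_integral hoi2 (ae_of_all _ fun z => sq_nonneg _)

end Path

/-! ### Measurability, the variational bound and the Gaussian tail. -/

section Random

variable {Ω : Type*} [MeasurableSpace Ω] {P : Measure Ω} {d : ℕ} {H : ℝ}
  {B : ℝ → Ω → EuclideanSpace ℝ (Fin d)} {B' : ℝ × Ω → EuclideanSpace ℝ (Fin d)} {T : ℝ}

lemma measurable_selfEnergy (hB' : Measurable B') :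
    Measurable fun ω => selfEnergy (fun t => B' (t, ω)) T := by
  have hs : MeasurableSet {p : (Ω × EuclideanSpace ℝ (Fin d)) × ℝ |
      p.2 ∈ Set.Icc 0 T ∧ B' (p.2, p.1.1) ∈ Metric.ball p.1.2 1} := by
    refine (measurable_snd measurableSet_Icc).inter ?_
    have h1 : Measurable fun p : (Ω × EuclideanSpace ℝ (Fin d)) × ℝ => B' (p.2, p.1.1) :=
      hB'.comp (measurable_snd.prodMk (measurable_fst.comp measurable_fst))
    exact measurableSet_lt (f := fun p : (Ω × EuclideanSpace ℝ (Fin d)) × ℝ =>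
      dist (B' (p.2, p.1.1)) p.1.2) (h1.dist (measurable_snd.comp measurable_fst)) measurable_const
  have h2 : Measurable fun p : Ω × EuclideanSpace ℝ (Fin d) =>
      occupationMeasure (fun t => B' (t, p.1)) T p.2 := measurable_measure_prodMk_left hs
  exact (h2.pow_const 2).lintegral_prod_right'

lemma measurable_path (hB' : Measurable B') (ω : Ω) : Measurable fun t => B' (t, ω) :=
  hB'.comp measurable_prodMk_right

lemma measurable_penalty (hB' : Measurable B') (β : ℝ) :
    Measurable fun ω => penalty β (fun t => B' (t, ω)) T := by
  simp_rw [penalty_eq (measurable_path hB' _)]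
  exact Real.measurable_exp.comp ((measurable_selfEnergy hB').ennreal_toReal.const_mul _)

lemma measurable_gyrationRadius (hB' : Measurable B') :
    Measurable fun ω => gyrationRadius (fun t => B' (t, ω)) T := by
  have h1 : Measurable fun p : Ω × ℝ => B' (p.2, p.1) := hB'.comp measurable_swap
  have hm : Measurable fun ω => timeMean (fun t => B' (t, ω)) T := by
    simp only [timeMean, intervalIntegral]
    have h3 (μ : Measure ℝ) [SFinite μ] : Measurable fun ω => ∫ t, B' (t, ω) ∂μ :=
      (h1.stronglyMeasurable.integral_prod_right' (ν := μ)).measurable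
    exact ((h3 (volume.restrict (Set.Ioc 0 T))).sub
      (h3 (volume.restrict (Set.Ioc T 0)))).const_smul (1 / T)
  have h2 : Measurable fun p : Ω × ℝ => ‖B' (p.2, p.1) - timeMean (fun t => B' (t, p.1)) T‖ ^ 2 :=
    ((h1.sub (hm.comp measurable_fst)).norm).pow_const 2
  have h3 (μ : Measure ℝ) [SFinite μ] : Measurable fun ω =>
      ∫ t, ‖B' (t, ω) - timeMean (fun t => B' (t, ω)) T‖ ^ 2 ∂μ :=
    (h2.stronglyMeasurable.integral_prod_right' (ν := μ)).measurable
  simp only [gyrationRadius, intervalIntegral]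
  exact (((h3 (volume.restrict (Set.Ioc 0 T))).sub
    (h3 (volume.restrict (Set.Ioc T 0)))).const_mul (1 / T)).sqrt

lemma penalty_pos (β : ℝ) (b : ℝ → EuclideanSpace ℝ (Fin d)) : 0 < penalty β b T := Real.exp_pos _

lemma penalty_le_one {β : ℝ} (hβ : 0 ≤ β) (b : ℝ → EuclideanSpace ℝ (Fin d)) :
    penalty β b T ≤ 1 := by
  refine Real.exp_le_one_iff.mpr ?_
  rw [neg_mul]
  exact neg_nonpos.mpr (mul_nonneg hβ (integral_nonneg fun _ => sq_nonneg _))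

lemma integrable_penalty [IsProbabilityMeasure P] (hB' : Measurable B') {β : ℝ} (hβ : 0 ≤ β) :
    Integrable (fun ω => penalty β (fun t => B' (t, ω)) T) P :=
  Integrable.of_bound (measurable_penalty hB' β).aestronglyMeasurable 1 (ae_of_all _ fun ω => by
    rw [Real.norm_of_nonneg (penalty_pos _ _).le]; exact penalty_le_one hβ _)

/-- Gibbs' variational lower bound for the partition function, with the tilted law. -/
lemma IsFBM.exp_neg_le_integral_penalty [IsProbabilityMeasure P] (hB : IsFBM H B P) (hH : 0 < H)
    (hB' : Measurable B') (i : Fin d) (a : ℝ) (hT : 0 ≤ T) {β Q : ℝ} (hβ : 0 ≤ β) (hQ : 0 ≤ Q)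
    (hE : ∫⁻ ω, selfEnergy (fun t => B' (t, ω)) T * ENNReal.ofReal (tiltDensity H B i a T ω) ∂P
      ≤ ENNReal.ofReal Q) :
    Real.exp (-(β * Q + a ^ 2 * T ^ (2 * H) / 2))
      ≤ ∫ ω, penalty β (fun t => B' (t, ω)) T ∂P := by
  set D := tiltDensity H B i a T with hD
  set X := fun ω => B T ω i with hX
  set σ2 := T ^ (2 * H) with hσ
  set E := fun ω => (selfEnergy (fun t => B' (t, ω)) T).toReal with hEdef
  have hDi : Integrable D P := hB.integrable_tiltDensity i a hT
  have hD1 : ∫ ω, D ω ∂P = 1 := hB.integral_tiltDensity hH i a hT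
  have hXD : Integrable (fun ω => X ω * D ω) P := hB.integrable_mul_tiltDensity i a hT
  have hXD1 : ∫ ω, X ω * D ω ∂P = a * σ2 := hB.integral_mul_tiltDensity hH i a hT
  have hDpos : ∀ ω, 0 < D ω := fun ω => tiltDensity_pos i a T ω
  have hmul : ∀ ω, selfEnergy (fun t => B' (t, ω)) T * ENNReal.ofReal (D ω)
      = ENNReal.ofReal (E ω * D ω) := fun ω => by
    rw [ENNReal.ofReal_mul ENNReal.toReal_nonneg,
      ENNReal.ofReal_toReal (selfEnergy_lt_top (measurable_path hB' ω)).ne]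
  simp_rw [hmul] at hE
  have hED0 : ∀ ω, 0 ≤ E ω * D ω := fun ω => mul_nonneg ENNReal.toReal_nonneg (hDpos ω).le
  have hEDm : AEStronglyMeasurable (fun ω => E ω * D ω) P :=
    (measurable_selfEnergy hB').ennreal_toReal.aestronglyMeasurable.mul hDi.1
  have hEDi : Integrable (fun ω => E ω * D ω) P := by
    refine ⟨hEDm, ?_⟩
    rw [hasFiniteIntegral_iff_ofReal (ae_of_all _ hED0)]
    exact hE.trans_lt ENNReal.ofReal_lt_top
  have hEDQ : ∫ ω, E ω * D ω ∂P ≤ Q := by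
    rw [← ofReal_integral_eq_lintegral_ofReal hEDi (ae_of_all _ hED0)] at hE
    exact (ENNReal.ofReal_le_ofReal_iff hQ).mp hE
  set m := -(β * Q + a ^ 2 * σ2 / 2) with hm
  have hi1 : Integrable (fun ω => (1 - m + a ^ 2 * σ2 / 2) * D ω) P := hDi.const_mul _
  have hi2 : Integrable (fun ω => β * (E ω * D ω)) P := hEDi.const_mul _
  have hi3 : Integrable (fun ω => a * (X ω * D ω)) P := hXD.const_mul _
  have hi12 : Integrable (fun ω => (1 - m + a ^ 2 * σ2 / 2) * D ω - β * (E ω * D ω)) P :=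
    hi1.sub hi2
  have hi123 : Integrable
      (fun ω => (1 - m + a ^ 2 * σ2 / 2) * D ω - β * (E ω * D ω) - a * (X ω * D ω)) P :=
    hi12.sub hi3
  -- With `x = log (penalty / D)`, the tangent bound `exp x ≥ exp m (1 + x - m)` is multiplied by
  -- `D` and integrated. As `m` is at most the tilted mean of `x`, the bracket has integral at least
  -- one; that mean uses `E[B_T^i D] = a T^{2H}`.
  calc Real.exp m
      ≤ Real.exp m * ∫ ω, ((1 - m + a ^ 2 * σ2 / 2) * D ω - β * (E ω * D ω) - a * (X ω * D ω)) ∂P := by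
        refine le_mul_of_one_le_right (Real.exp_pos _).le ?_
        rw [integral_sub hi12 hi3, integral_sub hi1 hi2, integral_const_mul, integral_const_mul,
          integral_const_mul, hD1, hXD1, hm]
        nlinarith [mul_le_mul_of_nonneg_left hEDQ hβ]
    _ = ∫ ω, Real.exp m
          * ((1 - m + a ^ 2 * σ2 / 2) * D ω - β * (E ω * D ω) - a * (X ω * D ω)) ∂P :=
        (integral_const_mul _ _).symm
    _ ≤ ∫ ω, penalty β (fun t => B' (t, ω)) T ∂P := by
        refine integral_mono (hi123.const_mul _) (integrable_penalty hB' hβ) fun ω => ?_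
        dsimp only
        rw [penalty_eq (measurable_path hB' ω)]
        have h1 : Real.exp (-β * E ω) = D ω * Real.exp m
            * Real.exp (-β * E ω - (a * X ω - a ^ 2 * σ2 / 2) - m) := by
          rw [hD, tiltDensity, ← Real.exp_add, ← Real.exp_add]
          congr 1; ring
        have h2 := Real.add_one_le_exp (-β * E ω - (a * X ω - a ^ 2 * σ2 / 2) - m)
        calc Real.exp m * ((1 - m + a ^ 2 * σ2 / 2) * D ω - β * (E ω * D ω) - a * (X ω * D ω))
            = D ω * Real.exp m * (-β * E ω - (a * X ω - a ^ 2 * σ2 / 2) - m + 1) := by ring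
          _ ≤ D ω * Real.exp m * Real.exp (-β * E ω - (a * X ω - a ^ 2 * σ2 / 2) - m) :=
              mul_le_mul_of_nonneg_left h2 (mul_nonneg (hDpos ω).le (Real.exp_pos _).le)
          _ = Real.exp (-β * E ω) := h1.symm

section Modification

variable [IsProbabilityMeasure P]

lemma ae_path_eq
    (hBB' : (fun p : ℝ × Ω => B p.1 p.2) =ᵐ[(volume.restrict (Set.Ici 0)).prod P] B') :
    ∀ᵐ ω ∂P, (fun t => B t ω) =ᵐ[volume.restrict (Set.Ici 0)] fun t => B' (t, ω) := by
  have h := Measure.measurePreserving_swap (μ := P) (ν := volume.restrict (Set.Ici (0 : ℝ)))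
  exact Measure.ae_ae_of_ae_prod (h.quasiMeasurePreserving.ae hBB')

lemma ae_time_eq
    (hBB' : (fun p : ℝ × Ω => B p.1 p.2) =ᵐ[(volume.restrict (Set.Ici 0)).prod P] B') :
    ∀ᵐ t ∂(volume.restrict (Set.Icc 0 T)), B t =ᵐ[P] fun ω => B' (t, ω) :=
  ae_restrict_Icc_of_Ici (Measure.ae_ae_of_ae_prod hBB')

/-- Tonelli, once for each time variable. It needs genuine joint measurability, which is the reason
for working with `B'` and a measurable representative of the density. -/
lemma lintegral_increment_swap (hB' : Measurable B') {ψ : EuclideanSpace ℝ (Fin d) → ENNReal}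
    (hψ : Measurable ψ) {D : Ω → ENNReal} (hD : Measurable D) {K : ENNReal} (hK : K ≠ ⊤) :
    ∫⁻ ω, (K * ∫⁻ s in Set.Icc 0 T, ∫⁻ t in Set.Icc 0 T, ψ (B' (t, ω) - B' (s, ω))) * D ω ∂P
      = K * ∫⁻ s in Set.Icc 0 T, ∫⁻ t in Set.Icc 0 T, ∫⁻ ω,
        ψ (B' (t, ω) - B' (s, ω)) * D ω ∂P := by
  have hF : Measurable fun p : (Ω × ℝ) × ℝ => ψ (B' (p.2, p.1.1) - B' (p.1.2, p.1.1)) * D p.1.1 := by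
    have h1 : Measurable fun p : (Ω × ℝ) × ℝ => B' (p.2, p.1.1) :=
      hB'.comp (measurable_snd.prodMk (measurable_fst.comp measurable_fst))
    have h2 : Measurable fun p : (Ω × ℝ) × ℝ => B' (p.1.2, p.1.1) :=
      hB'.comp (measurable_swap.comp measurable_fst)
    exact (hψ.comp (h1.sub h2)).mul (hD.comp (measurable_fst.comp measurable_fst))
  have hFt : ∀ s : ℝ, Measurable fun p : Ω × ℝ => ψ (B' (p.2, p.1) - B' (s, p.1)) * D p.1 :=
    fun s => hF.comp ((measurable_fst.prodMk measurable_const).prodMk measurable_snd)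
  have hψt : ∀ s ω, Measurable fun t => ψ (B' (t, ω) - B' (s, ω)) := fun s ω =>
    hψ.comp ((measurable_path hB' ω).sub_const _)
  have hψs : ∀ ω, Measurable fun s => ∫⁻ t in Set.Icc 0 T, ψ (B' (t, ω) - B' (s, ω)) := fun ω => by
    have h1 : Measurable fun p : ℝ × ℝ => ψ (B' (p.2, ω) - B' (p.1, ω)) :=
      hψ.comp (((measurable_path hB' ω).comp measurable_snd).sub
        ((measurable_path hB' ω).comp measurable_fst))
    exact h1.lintegral_prod_right'
  have h1 : ∀ ω, (K * ∫⁻ s in Set.Icc 0 T, ∫⁻ t in Set.Icc 0 T, ψ (B' (t, ω) - B' (s, ω))) * D ω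
      = K * ∫⁻ s in Set.Icc 0 T, ∫⁻ t in Set.Icc 0 T, ψ (B' (t, ω) - B' (s, ω)) * D ω := by
    intro ω
    simp_rw [lintegral_mul_const _ (hψt _ ω)]
    rw [lintegral_mul_const _ (hψs ω), ← mul_assoc]
  simp_rw [h1]
  rw [lintegral_const_mul' _ _ hK,
    lintegral_lintegral_swap hF.lintegral_prod_right'.aemeasurable]
  congr 1
  refine lintegral_congr fun s => ?_
  exact lintegral_lintegral_swap (hFt s).aemeasurable

/-- Fubini for the expected energy under the tilted law. -/
lemma IsFBM.lintegral_selfEnergy_mul_le (hB : IsFBM H B P)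
    (hBB' : (fun p : ℝ × Ω => B p.1 p.2) =ᵐ[(volume.restrict (Set.Ici 0)).prod P] B')
    (hB' : Measurable B') (i : Fin d) (a : ℝ) (hT : 0 ≤ T) :
    ∫⁻ ω, selfEnergy (fun t => B' (t, ω)) T * ENNReal.ofReal (tiltDensity H B i a T ω) ∂P
      ≤ volume (Metric.ball (0 : EuclideanSpace ℝ (Fin d)) 1)
        * ∫⁻ s in Set.Icc 0 T, ∫⁻ t in Set.Icc 0 T, ∫⁻ ω,
          Set.indicator {x | ‖x‖ < 2} 1 (B t ω - B s ω)
            * ENNReal.ofReal (tiltDensity H B i a T ω) ∂P := by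
  have hDm : AEMeasurable (fun ω => ENNReal.ofReal (tiltDensity H B i a T ω)) P :=
    (hB.integrable_tiltDensity i a hT).1.aemeasurable.ennreal_ofReal
  obtain ⟨D, hD, hDD⟩ := hDm
  have hS : MeasurableSet {x : EuclideanSpace ℝ (Fin d) | ‖x‖ < 2} :=
    measurableSet_lt (by fun_prop) measurable_const
  have h1 : ∫⁻ ω, selfEnergy (fun t => B' (t, ω)) T * ENNReal.ofReal (tiltDensity H B i a T ω) ∂P
      = ∫⁻ ω, selfEnergy (fun t => B' (t, ω)) T * D ω ∂P := by
    refine lintegral_congr_ae ?_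
    filter_upwards [hDD] with ω hω
    rw [hω]
  rw [h1]
  refine (lintegral_mono fun ω =>
    mul_le_mul_left (selfEnergy_le (measurable_path hB' ω)) (D ω)).trans ?_
  rw [lintegral_increment_swap hB' (measurable_one.indicator hS) hD measure_ball_lt_top.ne]
  refine le_of_eq (congrArg _ ?_)
  refine lintegral_congr_ae ?_
  filter_upwards [ae_time_eq (T := T) hBB'] with s hs
  refine lintegral_congr_ae ?_
  filter_upwards [ae_time_eq (T := T) hBB'] with t ht
  refine lintegral_congr_ae ?_
  filter_upwards [hs, ht, hDD] with ω h1 h2 h3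
  rw [h1, h2, h3]

lemma IsFBM.lintegral_lintegral_exp_le (hB : IsFBM H B P)
    (hBB' : (fun p : ℝ × Ω => B p.1 p.2) =ᵐ[(volume.restrict (Set.Ici 0)).prod P] B')
    (hH : 0 < H) (hB' : Measurable B') :
    ∫⁻ ω, (∫⁻ t in Set.Icc 0 T,
        ENNReal.ofReal (Real.exp (1 / (4 * T ^ (2 * H)) * ‖B' (t, ω)‖ ^ 2))) ∂P
      ≤ ENNReal.ofReal (√2 ^ d * T) := by
  have hm : Measurable fun p : Ω × ℝ =>
      ENNReal.ofReal (Real.exp (1 / (4 * T ^ (2 * H)) * ‖B' (p.2, p.1)‖ ^ 2)) := by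
    have h1 : Measurable fun p : Ω × ℝ => B' (p.2, p.1) := hB'.comp measurable_swap
    fun_prop
  rw [lintegral_lintegral_swap hm.aemeasurable]
  calc ∫⁻ t in Set.Icc 0 T, ∫⁻ ω,
        ENNReal.ofReal (Real.exp (1 / (4 * T ^ (2 * H)) * ‖B' (t, ω)‖ ^ 2)) ∂P
      ≤ ∫⁻ _t in Set.Icc 0 T, ENNReal.ofReal (√2) ^ d := by
        refine lintegral_mono_ae ?_
        -- At time zero the law is degenerate and has no density, so that single time is removed.
        have h0 : ∀ᵐ t ∂(volume.restrict (Set.Icc 0 T)), t ≠ 0 :=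
          ae_restrict_of_ae (Measure.ae_ne volume 0)
        filter_upwards [ae_time_eq (T := T) hBB', h0, ae_restrict_mem measurableSet_Icc]
          with t ht ht0 htT
        refine le_of_eq_of_le (lintegral_congr_ae ?_)
          (hB.lintegral_exp_norm_sq_le hH (lt_of_le_of_ne htT.1 ht0.symm) htT.2)
        filter_upwards [ht] with ω hω
        rw [hω]; congr 2; ring
    _ = ENNReal.ofReal (√2 ^ d * T) := by
        rw [setLIntegral_const, Real.volume_Icc, sub_zero, ENNReal.ofReal_mul (by positivity),
          ENNReal.ofReal_pow (by positivity)]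

/-- Gaussian tail of the radius of gyration. -/
lemma IsFBM.measure_gyrationRadius_ge_le (hB : IsFBM H B P)
    (hBB' : (fun p : ℝ × Ω => B p.1 p.2) =ᵐ[(volume.restrict (Set.Ici 0)).prod P] B')
    (hH : 0 < H) (hB' : Measurable B')
    (hT : 0 < T) {x : ℝ} (hx : 4 * d ≤ x) :
    P.real {ω | x * T ^ (2 * H) ≤ gyrationRadius (fun t => B' (t, ω)) T ^ 2}
      ≤ Real.exp (-(1 / 8 * x)) := by
  set l := 1 / (4 * T ^ (2 * H)) with hl
  have hTp : 0 < T ^ (2 * H) := by positivity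
  have hl0 : 0 < l := by positivity
  set S := {ω | x * T ^ (2 * H) ≤ gyrationRadius (fun t => B' (t, ω)) T ^ 2} with hS
  set F := fun ω => ∫⁻ t in Set.Icc 0 T, ENNReal.ofReal (Real.exp (l * ‖B' (t, ω)‖ ^ 2)) with hF
  have hFm : Measurable F := by
    have hm : Measurable fun p : Ω × ℝ =>
        ENNReal.ofReal (Real.exp (l * ‖B' (p.2, p.1)‖ ^ 2)) := by
      have h1 : Measurable fun p : Ω × ℝ => B' (p.2, p.1) := hB'.comp measurable_swap
      fun_prop
    exact hm.lintegral_prod_right'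
  -- Jensen bounds `T exp (l R²)` by the time integral `F`, and Markov's inequality is applied to
  -- `F`, whose mean is at most `√2^d T`.
  have hsub : S ⊆ {ω | ENNReal.ofReal (T * Real.exp (x / 4)) ≤ F ω} := by
    intro ω hω
    refine le_trans (ENNReal.ofReal_le_ofReal ?_)
      (mul_exp_gyrationRadius_sq_le (measurable_path hB' ω) hT hl0)
    gcongr
    calc x / 4 = l * (x * T ^ (2 * H)) := by rw [hl]; field_simp
      _ ≤ _ := mul_le_mul_of_nonneg_left hω hl0.le
  have h1 : ENNReal.ofReal (T * Real.exp (x / 4)) * P S ≤ ENNReal.ofReal (√2 ^ d * T) :=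
    (mul_le_mul_right (measure_mono hsub) _).trans
      ((mul_meas_ge_le_lintegral₀ hFm.aemeasurable _).trans
        (hB.lintegral_lintegral_exp_le hBB' hH hB'))
  have h2 : T * Real.exp (x / 4) * P.real S ≤ √2 ^ d * T := by
    have := ENNReal.toReal_mono ENNReal.ofReal_ne_top h1
    rwa [ENNReal.toReal_mul, ENNReal.toReal_ofReal (by positivity),
      ENNReal.toReal_ofReal (by positivity)] at this
  -- Since `√2 ≤ e^{1/2}`, the assumption `x ≥ 4d` lets half of the exponent `x / 4` absorb the
  -- dimensional prefactor.
  have h3 : √2 ^ d ≤ Real.exp (x / 8) := by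
    calc √2 ^ d ≤ (Real.exp (1 / 2)) ^ d := by
          gcongr
          rw [Real.sqrt_le_left (Real.exp_pos _).le, ← Real.exp_nat_mul]
          have := Real.add_one_le_exp (1 : ℝ)
          norm_num at this ⊢
          linarith
      _ = Real.exp (d * (1 / 2)) := (Real.exp_nat_mul _ _).symm
      _ ≤ Real.exp (x / 8) := by gcongr; linarith
  have h4 : Real.exp (x / 4) * P.real S ≤ Real.exp (x / 8) := by
    refine le_trans ?_ h3
    rw [← mul_le_mul_iff_right₀ hT]
    linarith
  calc P.real S = Real.exp (-(x / 4)) * (Real.exp (x / 4) * P.real S) := by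
        rw [← mul_assoc, ← Real.exp_add]; simp
    _ ≤ Real.exp (-(x / 4)) * Real.exp (x / 8) := by gcongr
    _ = Real.exp (-(1 / 8 * x)) := by rw [← Real.exp_add]; congr 1; ring

/-- Almost every path has finite second moment in time. -/
lemma IsFBM.ae_integrableOn_sq (hB : IsFBM H B P)
    (hBB' : (fun p : ℝ × Ω => B p.1 p.2) =ᵐ[(volume.restrict (Set.Ici 0)).prod P] B')
    (hH : 0 < H) (hB' : Measurable B')
    (hT : 0 < T) : ∀ᵐ ω ∂P, IntegrableOn (fun t => ‖B' (t, ω)‖ ^ 2) (Set.Icc 0 T) := by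
  set l := 1 / (4 * T ^ (2 * H)) with hl
  have hl0 : 0 < l := by positivity
  have hm : Measurable fun p : Ω × ℝ =>
      ENNReal.ofReal (Real.exp (l * ‖B' (p.2, p.1)‖ ^ 2)) := by
    have h1 : Measurable fun p : Ω × ℝ => B' (p.2, p.1) := hB'.comp measurable_swap
    fun_prop
  have h1 := ae_lt_top hm.lintegral_prod_right'
    ((hB.lintegral_lintegral_exp_le hBB' hH hB').trans_lt ENNReal.ofReal_lt_top).ne
  filter_upwards [h1] with ω hω
  have hbm := measurable_path hB' ω
  have hE : Integrable (fun t => l⁻¹ * Real.exp (l * ‖B' (t, ω)‖ ^ 2))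
      (volume.restrict (Set.Icc 0 T)) := by
    refine Integrable.const_mul ⟨Measurable.aestronglyMeasurable (by fun_prop), ?_⟩ _
    rw [hasFiniteIntegral_iff_ofReal (ae_of_all _ fun _ => (Real.exp_pos _).le)]
    exact hω
  refine hE.mono' (Measurable.aestronglyMeasurable (by fun_prop)) (ae_of_all _ fun t => ?_)
  rw [Real.norm_of_nonneg (by positivity), ← div_eq_inv_mul, le_div_iff₀ hl0]
  linarith [Real.add_one_le_exp (l * ‖B' (t, ω)‖ ^ 2)]

end Modification

end Random

/-! ### Return probabilities under the tilt and their time integrals. -/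

section Kernel

lemma min_one_pow_le {x : ENNReal} {k d : ℕ} (hkd : k ≤ d) : (min 1 x) ^ d ≤ x ^ k :=
  (pow_le_pow_right_of_le_one' (min_le_left _ _) hkd).trans (pow_le_pow_left' (min_le_right _ _) k)

lemma ofReal_two_div_sqrt_pow {H u : ℝ} (hu : 0 < u) (k : ℕ) :
    ENNReal.ofReal (2 / √(u ^ (2 * H))) ^ k = ENNReal.ofReal (2 ^ k * u ^ (-(k * H))) := by
  have h1 : √(u ^ (2 * H)) = u ^ H := by
    rw [mul_comm, Real.rpow_mul hu.le, Real.rpow_two, Real.sqrt_sq (by positivity)]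
  rw [h1, ← ENNReal.ofReal_pow (by positivity), div_pow, Real.rpow_neg hu.le, mul_comm (k : ℝ),
    Real.rpow_mul_natCast hu.le, div_eq_mul_inv]

variable {Ω : Type*} [MeasurableSpace Ω] {P : Measure Ω} {d : ℕ} {H : ℝ}
  {B : ℝ → Ω → EuclideanSpace ℝ (Fin d)} {T : ℝ}

/-- The probability, under the tilted law, that the paths at times `s` and `t` are at distance
less than two. -/
noncomputable def tiltedReturn (P : Measure Ω) (H : ℝ) (B : ℝ → Ω → EuclideanSpace ℝ (Fin d))
    (i : Fin d) (a T s t : ℝ) : ENNReal :=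
  ∫⁻ ω, Set.indicator {x | ‖x‖ < 2} 1 (B t ω - B s ω)
    * ENNReal.ofReal (tiltDensity H B i a T ω) ∂P

lemma tiltedReturn_comm (i : Fin d) (a s t : ℝ) :
    tiltedReturn P H B i a T s t = tiltedReturn P H B i a T t s := by
  refine lintegral_congr fun ω => ?_
  simp only [Set.indicator, Set.mem_ofPred_eq, norm_sub_rev (B t ω) (B s ω)]
  rfl

/-- The intensity of the tilt which produces a drift of speed at least `v`. -/
noncomputable def tiltIntensity (H v T : ℝ) : ℝ := v * T ^ (1 - 2 * H) / H

namespace IsFBM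

lemma tiltedReturn_le_one (hB : IsFBM H B P) (hH : 0 < H) (i : Fin d) (a s t : ℝ) (hT : 0 ≤ T) :
    tiltedReturn P H B i a T s t ≤ 1 := by
  rw [← hB.lintegral_tiltDensity hH i a hT]
  exact lintegral_mono fun ω =>
    mul_le_of_le_one_left' (Set.indicator_le_self' (fun _ _ => zero_le) _)

/-- Here `r` is the mean displacement given by the tilt to the increment. It depends on `s`, `t` and
`T` separately, but only its lower bound is needed later; the intensity is normalized so that the
powers of `T` cancel there. -/
lemma exists_tiltedReturn_le (hB : IsFBM H B P) (hH0 : 0 < H) (hH1 : H < 1) (i : Fin d)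
    {v s t : ℝ} (hv : 0 ≤ v) (hs : 0 ≤ s) (hst : s < t) (htT : t ≤ T) :
    ∃ r, v * (t - s) ≤ r ∧ tiltedReturn P H B i (tiltIntensity H v T) T s t
      ≤ (min 1 (ENNReal.ofReal (2 / √((t - s) ^ (2 * H))))) ^ d
        * ENNReal.ofReal (Real.exp ((2 * r - r ^ 2 / 2) / (t - s) ^ (2 * H))) := by
  have hT : 0 < T := hs.trans_lt (hst.trans_le htT)
  set c := (1 / 2) * (t ^ (2 * H) + T ^ (2 * H) - (T - t) ^ (2 * H))
        - (1 / 2) * (s ^ (2 * H) + T ^ (2 * H) - (T - s) ^ (2 * H)) with hc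
  have hcl : H * T ^ (2 * H - 1) * (t - s) ≤ c :=
    mul_le_endpoint_covariance hH0 hH1 hs hst.le htT
  have ha : 0 ≤ tiltIntensity H v T := by unfold tiltIntensity; positivity
  have hr : v * (t - s) ≤ tiltIntensity H v T * c := by
    calc v * (t - s) = tiltIntensity H v T * (H * T ^ (2 * H - 1) * (t - s)) := by
          have : T ^ (1 - 2 * H) * T ^ (2 * H - 1) = 1 := by
            rw [← Real.rpow_add hT]; simp
          unfold tiltIntensity
          field_simp
          linear_combination (-(v * (t - s))) * this
      _ ≤ _ := mul_le_mul_of_nonneg_left hcl ha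
  refine ⟨tiltIntensity H v T * c, hr, ?_⟩
  refine (hB.setLIntegral_tiltDensity_le hH0 i hs hst htT hc).trans (le_of_eq ?_)
  have hu : 0 < (t - s) ^ (2 * H) := Real.rpow_pos_of_pos (sub_pos.mpr hst) _
  have hr0 : 0 ≤ tiltIntensity H v T * c :=
    (mul_nonneg hv (sub_pos.mpr hst).le).trans hr
  rw [abs_of_nonneg (div_nonneg hr0 hu.le)]
  congr 3
  field_simp

/-- Once the displacement `r` is at least 8, `2r ≤ r² / 4` and half of the quadratic gain survives.
The number `k` of coordinates whose small-ball factor is kept is free: one when `H ≥ 1/2`, all when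
`dH < 1`. -/
lemma tiltedReturn_le_exp (hB : IsFBM H B P) (hH0 : 0 < H) (hH1 : H < 1) (i : Fin d)
    {v s t : ℝ} (hv : 0 ≤ v) (hs : 0 ≤ s) (hst : s < t) (htT : t ≤ T) (hvu : 8 ≤ v * (t - s))
    {k : ℕ} (hk : k ≤ d) :
    tiltedReturn P H B i (tiltIntensity H v T) T s t
      ≤ ENNReal.ofReal (2 ^ k * ((t - s) ^ (-(k * H))
        * Real.exp (-(v ^ 2 / 4) * (t - s) ^ (2 - 2 * H)))) := by
  obtain ⟨r, hr, h⟩ := hB.exists_tiltedReturn_le hH0 hH1 i hv hs hst htT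
  have hu : 0 < t - s := sub_pos.mpr hst
  have hu' : 0 < (t - s) ^ (2 * H) := by positivity
  refine h.trans ((mul_le_mul' (min_one_pow_le hk) le_rfl).trans ?_)
  rw [ofReal_two_div_sqrt_pow hu, ← ENNReal.ofReal_mul (by positivity), mul_assoc]
  refine ENNReal.ofReal_le_ofReal ?_
  gcongr
  have h1 : (t - s) ^ (2 - 2 * H) = (t - s) ^ 2 / (t - s) ^ (2 * H) := by
    rw [Real.rpow_sub hu, Real.rpow_two]
  rw [h1, ← mul_div_assoc]
  gcongr
  nlinarith [mul_le_mul hr hr (by positivity) (by linarith)]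

/-- The tilt can only harm by a constant: `2r - r²/2 ≤ 2` for every `r`, and for lags above one the
denominator is at least one. Shorter lags use the trivial bound by one. The case `v = 0` is
included. -/
lemma tiltedReturn_le_rpow (hB : IsFBM H B P) (hH0 : 0 < H) (hH1 : H < 1) (i : Fin d)
    {v s t : ℝ} (hv : 0 ≤ v) (hs : 0 ≤ s) (hst : s < t) (htT : t ≤ T) :
    tiltedReturn P H B i (tiltIntensity H v T) T s t
      ≤ ENNReal.ofReal (2 ^ d * Real.exp 2 * (t - s) ^ (-(d * H))) := by
  have hu : 0 < t - s := sub_pos.mpr hst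
  have hT : 0 < T := hs.trans_lt (hst.trans_le htT)
  have he : 1 ≤ Real.exp 2 := Real.one_le_exp (by norm_num)
  rcases le_total (t - s) 1 with h1 | h1
  · refine (hB.tiltedReturn_le_one hH0 i _ s t hT.le).trans ?_
    rw [ENNReal.one_le_ofReal]
    have h2 : 1 ≤ (t - s) ^ (-(d * H)) :=
      Real.one_le_rpow_of_pos_of_le_one_of_nonpos hu h1 (neg_nonpos.mpr (by positivity))
    have h3 : (1 : ℝ) ≤ 2 ^ d := one_le_pow₀ (by norm_num)
    exact one_le_mul_of_one_le_of_one_le (one_le_mul_of_one_le_of_one_le h3 he) h2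
  · obtain ⟨r, hr, h⟩ := hB.exists_tiltedReturn_le hH0 hH1 i hv hs hst htT
    refine h.trans ((mul_le_mul' (min_one_pow_le le_rfl) le_rfl).trans ?_)
    rw [ofReal_two_div_sqrt_pow hu, ← ENNReal.ofReal_mul (by positivity), mul_right_comm]
    refine ENNReal.ofReal_le_ofReal ?_
    gcongr
    have h2 : 1 ≤ (t - s) ^ (2 * H) := Real.one_le_rpow h1 (by positivity)
    rw [div_le_iff₀ (by linarith)]
    nlinarith [sq_nonneg (r - 2)]

end IsFBM

/-- The two orderings of `s` and `t` give the factor two, and the diagonal is null. With `q`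
extended by zero, translation and reflection bound the inner integral uniformly in `s`. -/
lemma lintegral_lintegral_le_of_difference {p : ℝ → ℝ → ENNReal} {q : ℝ → ENNReal}
    (hq : Measurable q) (hsymm : ∀ s t, p s t = p t s)
    (hpq : ∀ s t, 0 ≤ s → s < t → t ≤ T → p s t ≤ q (t - s)) :
    ∫⁻ s in Set.Icc 0 T, ∫⁻ t in Set.Icc 0 T, p s t
      ≤ ENNReal.ofReal T * (2 * ∫⁻ u in Set.Ioc 0 T, q u) := by
  set f := (Set.Ioc 0 T).indicator q with hf
  have hfm : Measurable f := hq.indicator measurableSet_Ioc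
  have hfi : ∫⁻ u, f u = ∫⁻ u in Set.Ioc 0 T, q u := lintegral_indicator measurableSet_Ioc _
  have hs : ∀ s ∈ Set.Icc 0 T, ∫⁻ t in Set.Icc 0 T, p s t ≤ 2 * ∫⁻ u in Set.Ioc 0 T, q u := by
    intro s hs
    calc ∫⁻ t in Set.Icc 0 T, p s t ≤ ∫⁻ t in Set.Icc 0 T, (f (t - s) + f (s - t)) := by
          refine lintegral_mono_ae ?_
          have h0 : ∀ᵐ t ∂(volume.restrict (Set.Icc 0 T)), t ≠ s :=
            ae_restrict_of_ae (Measure.ae_ne volume s)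
          filter_upwards [h0, ae_restrict_mem measurableSet_Icc] with t ht htT
          rcases lt_or_gt_of_ne ht with h | h
          · have hmem : s - t ∈ Set.Ioc 0 T := ⟨by linarith, by linarith [htT.1, hs.2]⟩
            refine le_trans ?_ le_add_self
            rw [hf, Set.indicator_of_mem hmem, hsymm]
            exact hpq t s htT.1 h hs.2
          · have hmem : t - s ∈ Set.Ioc 0 T := ⟨by linarith, by linarith [htT.2, hs.1]⟩
            refine le_trans ?_ le_self_add
            rw [hf, Set.indicator_of_mem hmem]
            exact hpq s t hs.1 h htT.2
      _ ≤ ∫⁻ t, (f (t - s) + f (s - t)) := setLIntegral_le_lintegral _ _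
      _ = 2 * ∫⁻ u in Set.Ioc 0 T, q u := by
          have h1 : Measurable fun t => f (t - s) := hfm.comp (measurable_sub_const s)
          rw [lintegral_add_left h1,
            lintegral_sub_right_eq_self f s, lintegral_sub_left_eq_self f s, hfi, two_mul]
  calc ∫⁻ s in Set.Icc 0 T, ∫⁻ t in Set.Icc 0 T, p s t
      ≤ ∫⁻ _s in Set.Icc 0 T, 2 * ∫⁻ u in Set.Ioc 0 T, q u :=
        setLIntegral_mono' measurableSet_Icc hs
    _ = _ := by
        rw [setLIntegral_const, Real.volume_Icc, sub_zero, mul_comm]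

lemma lintegral_rpow_neg_mul_exp {θ H w : ℝ} (hθ : θ < 1) (hH : H < 1) (hw : 0 < w) :
    ∫⁻ u in Set.Ioi 0, ENNReal.ofReal (u ^ (-θ) * Real.exp (-w * u ^ (2 - 2 * H)))
      = ENNReal.ofReal (w ^ (-(1 - θ) / (2 - 2 * H))
        * ((1 / (2 - 2 * H)) * Real.Gamma ((1 - θ) / (2 - 2 * H)))) := by
  have hp : 0 < 2 - 2 * H := by linarith
  have h1 := integral_rpow_mul_exp_neg_mul_rpow hp (show -1 < -θ by linarith) hw
  have h2 := integrableOn_rpow_mul_exp_neg_mul_rpow (show -1 < -θ by linarith) hp hw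
  rw [← ofReal_integral_eq_lintegral_ofReal h2 ?_, h1]
  · congr 1
    rw [show -θ + 1 = 1 - θ by ring, mul_assoc]
  · filter_upwards [ae_restrict_mem measurableSet_Ioi] with u hu
    have : (0 : ℝ) < u := hu
    positivity

lemma lintegral_rpow_neg_Ioc {θ L : ℝ} (hθ : θ < 1) (hL : 0 ≤ L) :
    ∫⁻ u in Set.Ioc 0 L, ENNReal.ofReal (u ^ (-θ)) = ENNReal.ofReal (L ^ (1 - θ) / (1 - θ)) := by
  have h1 : IntervalIntegrable (fun u : ℝ => u ^ (-θ)) volume 0 L :=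
    intervalIntegral.intervalIntegrable_rpow' (by linarith)
  have h2 := (intervalIntegrable_iff_integrableOn_Ioc_of_le hL).mp h1
  rw [← ofReal_integral_eq_lintegral_ofReal h2 ?_, ← intervalIntegral.integral_of_le hL,
    integral_rpow (Or.inl (by linarith)), Real.zero_rpow (by linarith)]
  · congr 1
    rw [show -θ + 1 = 1 - θ by ring, sub_zero]
  · filter_upwards [ae_restrict_mem measurableSet_Ioc] with u hu
    have : (0 : ℝ) < u := hu.1
    positivity

/-- A bound on the partition function from a bound on the tilted return probabilities. -/
lemma IsFBM.exp_neg_le_integral_penalty_of_kernel [IsProbabilityMeasure P] (hB : IsFBM H B P)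
    {B' : ℝ × Ω → EuclideanSpace ℝ (Fin d)} (hH : 0 < H)
    (hBB' : (fun p : ℝ × Ω => B p.1 p.2) =ᵐ[(volume.restrict (Set.Ici 0)).prod P] B')
    (hB' : Measurable B') (i : Fin d) {v : ℝ} (hT : 0 < T) {β Q : ℝ} (hβ : 0 ≤ β) (hQ : 0 ≤ Q)
    {q : ℝ → ENNReal} (hq : Measurable q)
    (hpq : ∀ s t, 0 ≤ s → s < t → t ≤ T →
      tiltedReturn P H B i (tiltIntensity H v T) T s t ≤ q (t - s))
    (hqQ : ∫⁻ u in Set.Ioc 0 T, q u ≤ ENNReal.ofReal Q) :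
    Real.exp (-(2 * volume.real (Metric.ball (0 : EuclideanSpace ℝ (Fin d)) 1) * (β * T * Q)
        + v ^ 2 * T ^ (2 - 2 * H) / (2 * H ^ 2)))
      ≤ ∫ ω, penalty β (fun t => B' (t, ω)) T ∂P := by
  set K := volume.real (Metric.ball (0 : EuclideanSpace ℝ (Fin d)) 1) with hK
  have hK0 : 0 ≤ K := measureReal_nonneg
  have h1 := hB.exp_neg_le_integral_penalty hH hB' i (tiltIntensity H v T) hT.le hβ
    (show 0 ≤ K * (T * (2 * Q)) by positivity) ?_
  · refine le_trans (Real.exp_le_exp.mpr (neg_le_neg ?_)) h1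
    have h2 : tiltIntensity H v T ^ 2 * T ^ (2 * H) = v ^ 2 * T ^ (2 - 2 * H) / H ^ 2 := by
      have : T ^ (2 - 2 * H) = (T ^ (1 - 2 * H)) ^ 2 * T ^ (2 * H) := by
        rw [← Real.rpow_mul_natCast hT.le, ← Real.rpow_add hT]; congr 1; push_cast; ring
      rw [this, tiltIntensity]; field_simp
    rw [h2]
    refine le_of_eq ?_
    field_simp
  · refine (hB.lintegral_selfEnergy_mul_le hBB' hB' i _ hT.le).trans ?_
    rw [ENNReal.ofReal_mul hK0, ENNReal.ofReal_mul hT.le, ENNReal.ofReal_mul two_pos.le, hK,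
      measureReal_def, ENNReal.ofReal_toReal measure_ball_lt_top.ne, ENNReal.ofReal_ofNat]
    gcongr
    refine (lintegral_lintegral_le_of_difference hq (fun s t => tiltedReturn_comm i _ s t)
      hpq).trans ?_
    gcongr

end Kernel

-- Partition function bounds with and without drift.

universe u

/-- The partition function at time `T` is at least `exp (-r)`, whatever the realization of the
fractional Brownian motion. -/
def PartitionLowerBound (d : ℕ) (H β T r : ℝ) : Prop :=
  ∀ (Ω : Type u) [MeasurableSpace Ω] (P : Measure Ω) [IsProbabilityMeasure P]
    (B : ℝ → Ω → EuclideanSpace ℝ (Fin d)) (B' : ℝ × Ω → EuclideanSpace ℝ (Fin d)),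
    IsFBM H B P →
    (fun p : ℝ × Ω => B p.1 p.2) =ᵐ[(volume.restrict (Set.Ici 0)).prod P] B' →
    Measurable B' →
    Real.exp (-r) ≤ ∫ ω, penalty β (fun t => B' (t, ω)) T ∂P

variable {d : ℕ} {H : ℝ}

lemma PartitionLowerBound.mono {β T r r' : ℝ} (h : PartitionLowerBound.{u} d H β T r)
    (hr : r ≤ r') : PartitionLowerBound.{u} d H β T r' := by
  intro Ω _ P _ B B' hB hBB' hB'
  exact (Real.exp_le_exp.mpr (neg_le_neg hr)).trans (h Ω P B B' hB hBB' hB')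

lemma two_mul_add_le {K A H x y : ℝ} (hK : 0 ≤ K) (hA : 0 ≤ A) (hx : 0 ≤ x) (hy : 0 ≤ y) :
    2 * K * (x * A) + y / (2 * H ^ 2) ≤ (2 * K * A + 1 / (2 * H ^ 2)) * (x + y) := by
  have h1 : 0 ≤ 2 * K * A * y := by positivity
  have h2 : 0 ≤ 1 / (2 * H ^ 2) * x := by positivity
  have h3 : y / (2 * H ^ 2) = 1 / (2 * H ^ 2) * y := by ring
  rw [h3]
  nlinarith

/-- Linear drift, using the return probabilities of one coordinate. -/
lemma exists_partitionLowerBound_of_one_le (hd : 1 ≤ d) (hH0 : 0 < H) (hH1 : H < 1) :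
    ∃ C : ℝ, 0 < C ∧ ∀ β v T : ℝ, 0 < β → 0 < v → 0 < T →
      PartitionLowerBound.{u} d H β T (C * (β * T / v + v ^ 2 * T ^ (2 - 2 * H))) := by
  set K := volume.real (Metric.ball (0 : EuclideanSpace ℝ (Fin d)) 1) with hK
  have hK0 : 0 ≤ K := measureReal_nonneg
  have hH2 : 0 < 2 - 2 * H := by linarith
  set G := (1 / (2 - 2 * H)) * Real.Gamma ((1 - H) / (2 - 2 * H)) with hG
  have hG0 : 0 < G := mul_pos (by positivity) (Real.Gamma_pos_of_pos (div_pos (by linarith) hH2))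
  refine ⟨2 * K * (8 + 2 * (2 * G)) + 1 / (2 * H ^ 2), by positivity, ?_⟩
  intro β v T hβ hv hT Ω _ P _ B B' hB hBB' hB'
  -- Lags below `8 / v` are charged the trivial probability one, which already costs `8 / v`;
  -- beyond, the drift dominates and one coordinate suffices for integrability because `H < 1`.
  set q : ℝ → ENNReal := fun u => (Set.Ioo 0 (8 / v)).indicator 1 u
    + ENNReal.ofReal (2 * (u ^ (-H) * Real.exp (-(v ^ 2 / 4) * u ^ (2 - 2 * H)))) with hq
  have hqm : Measurable q :=
    (measurable_one.indicator measurableSet_Ioo).add (by fun_prop)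
  have hqi : ∫⁻ u in Set.Ioc 0 T, q u ≤ ENNReal.ofReal ((8 + 2 * (2 * G)) / v) := by
    -- With a single factor `u^{-H}` the scaling exponent is `-1/2` for every `H`, so both lag
    -- ranges cost a multiple of `1 / v`.
    have h1 : (v ^ 2 / 4) ^ (-(1 - H) / (2 - 2 * H)) = 2 / v := by
      have h0 : 1 - H ≠ 0 := by linarith
      rw [show -(1 - H) / (2 - 2 * H) = -(1 / 2) by
          rw [show 2 - 2 * H = 2 * (1 - H) by ring]; field_simp,
        show v ^ 2 / 4 = (v / 2) ^ (2 : ℝ) by rw [Real.rpow_two]; ring,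
        ← Real.rpow_mul (by positivity)]
      norm_num [Real.rpow_neg_one]
    calc ∫⁻ u in Set.Ioc 0 T, q u ≤ ∫⁻ u in Set.Ioi 0, q u :=
          lintegral_mono_set fun u hu => hu.1
      _ = (∫⁻ u in Set.Ioi 0, (Set.Ioo 0 (8 / v)).indicator 1 u)
          + ∫⁻ u in Set.Ioi 0, ENNReal.ofReal
            (2 * (u ^ (-H) * Real.exp (-(v ^ 2 / 4) * u ^ (2 - 2 * H)))) :=
          lintegral_add_left (measurable_one.indicator measurableSet_Ioo) _
      _ ≤ ENNReal.ofReal (8 / v) + ENNReal.ofReal (2 * (2 / v * G)) := by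
          refine add_le_add ?_ ?_
          · refine (setLIntegral_le_lintegral _ _).trans ?_
            rw [lintegral_indicator_one measurableSet_Ioo, Real.volume_Ioo, sub_zero]
          · simp_rw [ENNReal.ofReal_mul two_pos.le]
            rw [lintegral_const_mul' _ _ ENNReal.ofReal_ne_top,
              lintegral_rpow_neg_mul_exp hH1 hH1 (by positivity), h1]
      _ = ENNReal.ofReal ((8 + 2 * (2 * G)) / v) := by
          rw [← ENNReal.ofReal_add (by positivity) (by positivity)]
          congr 1; ring
  refine le_trans (Real.exp_le_exp.mpr (neg_le_neg ?_))
    (hB.exp_neg_le_integral_penalty_of_kernel hH0 hBB' hB' ⟨0, hd⟩ hT hβ.le (by positivity) hqm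
      (v := v) ?_ hqi)
  · have := two_mul_add_le (K := K) (A := 8 + 2 * (2 * G)) (H := H) (x := β * T / v)
      (y := v ^ 2 * T ^ (2 - 2 * H)) hK0 (by positivity) (by positivity) (by positivity)
    refine le_trans (le_of_eq ?_) this
    ring
  · intro s t hs hst htT
    have hu : 0 < t - s := sub_pos.mpr hst
    rcases lt_or_ge (t - s) (8 / v) with h | h
    · refine (hB.tiltedReturn_le_one hH0 _ _ s t hT.le).trans ?_
      have hmem : t - s ∈ Set.Ioo 0 (8 / v) := ⟨hu, h⟩
      simp [hq, hmem]
    · have h8 : 8 ≤ v * (t - s) := (div_le_iff₀' hv).mp h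
      refine (hB.tiltedReturn_le_exp hH0 hH1 _ hv.le hs hst htT h8 hd).trans ?_
      refine le_trans (le_of_eq ?_) le_add_self
      simp

/-- Linear drift of small speed, using the return probabilities of all coordinates. -/
lemma exists_partitionLowerBound_of_mul_lt_one (hd : 1 ≤ d) (hH0 : 0 < H) (hH1 : H < 1)
    (hdH : d * H < 1) :
    ∃ C : ℝ, 0 < C ∧ ∀ β v T : ℝ, 0 < β → 0 < v → v ≤ 1 → 0 < T →
      PartitionLowerBound.{u} d H β T
        (C * (β * T * v ^ (-((1 - d * H) / (1 - H))) + v ^ 2 * T ^ (2 - 2 * H))) := by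
  set K := volume.real (Metric.ball (0 : EuclideanSpace ℝ (Fin d)) 1) with hK
  have hK0 : 0 ≤ K := measureReal_nonneg
  have hH2 : 0 < 2 - 2 * H := by linarith
  set θ := d * H with hθ
  have hθ1 : 0 < 1 - θ := by linarith
  set G := (1 / (2 - 2 * H)) * Real.Gamma ((1 - θ) / (2 - 2 * H)) with hG
  have hG0 : 0 < G := mul_pos (by positivity) (Real.Gamma_pos_of_pos (div_pos (by linarith) hH2))
  set ρ := (1 - θ) / (1 - H) with hρ
  have hρ0 : 0 < ρ := div_pos hθ1 (by linarith)
  set A := (2 : ℝ) ^ d * Real.exp 2 with hA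
  have hA0 : 0 < A := by positivity
  have hA2 : (2 : ℝ) ^ d ≤ A := le_mul_of_one_le_right (by positivity) (Real.one_le_exp (by norm_num))
  set Q := A * (8 ^ (1 - θ) / (1 - θ)) + A * (2 ^ ρ * G) with hQ
  have hQ0 : 0 < Q := by positivity
  refine ⟨2 * K * Q + 1 / (2 * H ^ 2), by positivity, ?_⟩
  intro β v T hβ hv hv1 hT Ω _ P _ B B' hB hBB' hB'
  set q : ℝ → ENNReal := fun u =>
    (Set.Ioc 0 (8 / v)).indicator (fun u => ENNReal.ofReal (A * u ^ (-θ))) u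
    + ENNReal.ofReal (A * (u ^ (-θ) * Real.exp (-(v ^ 2 / 4) * u ^ (2 - 2 * H)))) with hq
  have hqm1 : Measurable ((Set.Ioc 0 (8 / v)).indicator (fun u => ENNReal.ofReal (A * u ^ (-θ)))) :=
    Measurable.indicator (by fun_prop) measurableSet_Ioc
  have hqm : Measurable q := hqm1.add (by fun_prop)
  have hqi : ∫⁻ u in Set.Ioc 0 T, q u ≤ ENNReal.ofReal (Q * v ^ (-ρ)) := by
    have h1 : (v ^ 2 / 4) ^ (-(1 - θ) / (2 - 2 * H)) = 2 ^ ρ * v ^ (-ρ) := by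
      have h0 : 1 - H ≠ 0 := by linarith
      rw [show -(1 - θ) / (2 - 2 * H) = (1 / 2) * (-ρ) by
          rw [hρ, show 2 - 2 * H = 2 * (1 - H) by ring]; field_simp,
        Real.rpow_mul (by positivity), ← Real.sqrt_eq_rpow,
        show v ^ 2 / 4 = (v / 2) ^ 2 by ring, Real.sqrt_sq (by positivity),
        Real.div_rpow hv.le two_pos.le, Real.rpow_neg two_pos.le]
      field_simp
    -- The restriction `v ≤ 1` enters here: as `ρ ≥ 1 - θ`, the short lags cost no more than the
    -- long ones, up to a constant.
    have h2 : (8 / v) ^ (1 - θ) ≤ 8 ^ (1 - θ) * v ^ (-ρ) := by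
      rw [Real.div_rpow (by norm_num) hv.le, div_eq_mul_inv, ← Real.rpow_neg hv.le]
      refine mul_le_mul_of_nonneg_left ?_ (by positivity)
      refine Real.rpow_le_rpow_of_exponent_ge hv hv1 (neg_le_neg ?_)
      rw [hρ, le_div_iff₀ (by linarith)]
      nlinarith
    calc ∫⁻ u in Set.Ioc 0 T, q u ≤ ∫⁻ u in Set.Ioi 0, q u :=
          lintegral_mono_set fun u hu => hu.1
      _ = (∫⁻ u in Set.Ioi 0,
            (Set.Ioc 0 (8 / v)).indicator (fun u => ENNReal.ofReal (A * u ^ (-θ))) u)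
          + ∫⁻ u in Set.Ioi 0, ENNReal.ofReal
            (A * (u ^ (-θ) * Real.exp (-(v ^ 2 / 4) * u ^ (2 - 2 * H)))) :=
          lintegral_add_left hqm1 _
      _ ≤ ENNReal.ofReal (A * (8 ^ (1 - θ) / (1 - θ)) * v ^ (-ρ))
          + ENNReal.ofReal (A * (2 ^ ρ * v ^ (-ρ) * G)) := by
          refine add_le_add ?_ ?_
          · refine (setLIntegral_le_lintegral _ _).trans ?_
            rw [lintegral_indicator measurableSet_Ioc]
            simp_rw [ENNReal.ofReal_mul hA0.le]
            rw [lintegral_const_mul' _ _ ENNReal.ofReal_ne_top,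
              lintegral_rpow_neg_Ioc hdH (by positivity), ← ENNReal.ofReal_mul hA0.le]
            refine ENNReal.ofReal_le_ofReal ?_
            calc A * ((8 / v) ^ (1 - θ) / (1 - θ)) ≤ A * (8 ^ (1 - θ) * v ^ (-ρ) / (1 - θ)) := by
                  gcongr
              _ = _ := by ring
          · simp_rw [ENNReal.ofReal_mul hA0.le]
            rw [lintegral_const_mul' _ _ ENNReal.ofReal_ne_top,
              lintegral_rpow_neg_mul_exp hdH hH1 (by positivity), h1]
      _ = ENNReal.ofReal (Q * v ^ (-ρ)) := by
          rw [← ENNReal.ofReal_add (by positivity) (by positivity)]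
          congr 1; rw [hQ]; ring
  refine le_trans (Real.exp_le_exp.mpr (neg_le_neg ?_))
    (hB.exp_neg_le_integral_penalty_of_kernel hH0 hBB' hB' ⟨0, hd⟩ hT hβ.le (by positivity) hqm
      (v := v) ?_ hqi)
  · have := two_mul_add_le (K := K) (A := Q) (H := H) (x := β * T * v ^ (-ρ))
      (y := v ^ 2 * T ^ (2 - 2 * H)) hK0 hQ0.le (by positivity) (by positivity)
    refine le_trans (le_of_eq ?_) this
    ring
  · intro s t hs hst htT
    have hu : 0 < t - s := sub_pos.mpr hst
    rcases lt_or_ge (t - s) (8 / v) with h | h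
    · refine (hB.tiltedReturn_le_rpow hH0 hH1 _ hv.le hs hst htT).trans ?_
      have hmem : t - s ∈ Set.Ioc 0 (8 / v) := ⟨hu, h.le⟩
      refine le_trans (le_of_eq ?_) le_self_add
      rw [Set.indicator_of_mem hmem]
    · have h8 : 8 ≤ v * (t - s) := (div_le_iff₀' hv).mp h
      refine (hB.tiltedReturn_le_exp hH0 hH1 _ hv.le hs hst htT h8 le_rfl).trans ?_
      refine le_trans (ENNReal.ofReal_le_ofReal ?_) le_add_self
      gcongr

/-- No drift. -/
lemma partitionLowerBound_of_lintegral_le (hd : 1 ≤ d) (hH0 : 0 < H) (hH1 : H < 1)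
    {β T Q : ℝ} (hβ : 0 < β) (hT : 1 ≤ T) (hQ : 0 ≤ Q)
    (h : ∫⁻ u in Set.Ioc 1 T, ENNReal.ofReal (u ^ (-(d * H))) ≤ ENNReal.ofReal Q) :
    PartitionLowerBound.{u} d H β T
      (2 * volume.real (Metric.ball (0 : EuclideanSpace ℝ (Fin d)) 1)
        * (β * T * (1 + 2 ^ d * Real.exp 2 * Q))) := by
  intro Ω _ P _ B B' hB hBB' hB'
  set A := (2 : ℝ) ^ d * Real.exp 2 with hA
  have hA0 : 0 < A := by positivity
  set q : ℝ → ENNReal := fun u => (Set.Ioc 0 1).indicator 1 u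
    + (Set.Ioi 1).indicator (fun u => ENNReal.ofReal (A * u ^ (-(d * H)))) u with hq
  have hqm1 : Measurable ((Set.Ioc (0 : ℝ) 1).indicator (1 : ℝ → ENNReal)) :=
    measurable_one.indicator measurableSet_Ioc
  have hqm : Measurable q := hqm1.add (Measurable.indicator (by fun_prop) measurableSet_Ioi)
  have hqi : ∫⁻ u in Set.Ioc 0 T, q u ≤ ENNReal.ofReal (1 + A * Q) := by
    rw [lintegral_add_left hqm1, ENNReal.ofReal_add zero_le_one (by positivity)]
    refine add_le_add ?_ ?_
    · refine (setLIntegral_le_lintegral _ _).trans ?_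
      rw [lintegral_indicator_one measurableSet_Ioc, Real.volume_Ioc, sub_zero]
    · rw [setLIntegral_indicator measurableSet_Ioi]
      have hset : Set.Ioi (1 : ℝ) ∩ Set.Ioc 0 T = Set.Ioc 1 T := by
        ext u
        simp only [Set.mem_inter_iff, Set.mem_Ioi, Set.mem_Ioc]
        exact ⟨fun h => ⟨h.1, h.2.2⟩, fun h => ⟨h.1, zero_lt_one.trans h.1, h.2⟩⟩
      rw [hset]
      simp_rw [ENNReal.ofReal_mul hA0.le]
      rw [lintegral_const_mul' _ _ ENNReal.ofReal_ne_top]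
      gcongr
  have hT0 : 0 < T := zero_lt_one.trans_le hT
  refine le_of_eq_of_le ?_
    (hB.exp_neg_le_integral_penalty_of_kernel hH0 hBB' hB' ⟨0, hd⟩ hT0 hβ.le (by positivity) hqm
      (v := 0) ?_ hqi)
  · congr 2; ring
  · intro s t hs hst htT
    have hu : 0 < t - s := sub_pos.mpr hst
    rcases le_or_gt (t - s) 1 with h | h
    · refine (hB.tiltedReturn_le_one hH0 _ _ s t hT0.le).trans ?_
      have hmem : t - s ∈ Set.Ioc 0 1 := ⟨hu, h⟩
      simp [hq, hmem]
    · refine (hB.tiltedReturn_le_rpow hH0 hH1 _ le_rfl hs hst htT).trans ?_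
      have hmem : t - s ∈ Set.Ioi 1 := h
      refine le_trans (le_of_eq ?_) le_add_self
      rw [Set.indicator_of_mem hmem]

lemma exists_partitionLowerBound_of_mul_eq_one (hd : 1 ≤ d) (hH0 : 0 < H) (hH1 : H < 1)
    (hdH : d * H = 1) :
    ∃ C : ℝ, 0 < C ∧ ∀ β T : ℝ, 0 < β → Real.exp 1 ≤ T →
      PartitionLowerBound.{u} d H β T (C * (β * (T * Real.log T))) := by
  set K := volume.real (Metric.ball (0 : EuclideanSpace ℝ (Fin d)) 1) with hK
  have hK0 : 0 ≤ K := measureReal_nonneg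
  set A := (2 : ℝ) ^ d * Real.exp 2 with hA
  have hA0 : 0 < A := by positivity
  -- The extra `1` guarantees a positive constant, since only `K ≥ 0` is recorded.
  refine ⟨2 * K * (1 + A) + 1, by positivity, fun β T hβ hT => ?_⟩
  have hT1 : 1 ≤ T := le_trans (Real.one_le_exp zero_le_one) hT
  have hT0 : 0 < T := zero_lt_one.trans_le hT1
  have hlog : 1 ≤ Real.log T := (Real.le_log_iff_exp_le hT0).mpr hT
  have hint : ∫⁻ u in Set.Ioc 1 T, ENNReal.ofReal (u ^ (-(d * H)))
      ≤ ENNReal.ofReal (Real.log T) := by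
    have h0 : (0 : ℝ) ∉ Set.uIcc 1 T := by
      rw [Set.uIcc_of_le hT1]; exact fun h => absurd h.1 (by norm_num)
    have h1 : IntervalIntegrable (fun u : ℝ => u⁻¹) volume 1 T :=
      intervalIntegrable_inv_iff.mpr (Or.inr h0)
    have h2 := (intervalIntegrable_iff_integrableOn_Ioc_of_le hT1).mp h1
    rw [hdH]
    simp_rw [Real.rpow_neg_one]
    rw [← ofReal_integral_eq_lintegral_ofReal h2 ?_, ← intervalIntegral.integral_of_le hT1,
      integral_inv h0, div_one]
    filter_upwards [ae_restrict_mem measurableSet_Ioc] with u hu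
    exact inv_nonneg.mpr (zero_lt_one.trans hu.1).le
  refine (partitionLowerBound_of_lintegral_le hd hH0 hH1 hβ hT1 (by linarith) hint).mono ?_
  -- The short-lag contribution is absorbed thanks to `log T ≥ 1`, that is, `T ≥ e`.
  have h1 : 1 + A * Real.log T ≤ (1 + A) * Real.log T := by nlinarith
  have h2 : 0 ≤ β * (T * Real.log T) := by positivity
  calc 2 * K * (β * T * (1 + A * Real.log T)) ≤ 2 * K * (β * T * ((1 + A) * Real.log T)) := by
        gcongr
    _ ≤ _ := by nlinarith

lemma exists_partitionLowerBound_of_one_lt_mul (hd : 1 ≤ d) (hH0 : 0 < H) (hH1 : H < 1)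
    (hdH : 1 < d * H) :
    ∃ C : ℝ, 0 < C ∧ ∀ β T : ℝ, 0 < β → 1 ≤ T →
      PartitionLowerBound.{u} d H β T (C * (β * T)) := by
  set K := volume.real (Metric.ball (0 : EuclideanSpace ℝ (Fin d)) 1) with hK
  have hK0 : 0 ≤ K := measureReal_nonneg
  set A := (2 : ℝ) ^ d * Real.exp 2 with hA
  have hA0 : 0 < A := by positivity
  have hθ : 0 < d * H - 1 := by linarith
  refine ⟨2 * K * (1 + A * (1 / (d * H - 1))) + 1, by positivity, fun β T hβ hT => ?_⟩
  have hT0 : 0 < T := zero_lt_one.trans_le hT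
  have hint : ∫⁻ u in Set.Ioc 1 T, ENNReal.ofReal (u ^ (-(d * H)))
      ≤ ENNReal.ofReal (1 / (d * H - 1)) := by
    have h1 := integrableOn_Ioi_rpow_of_lt (show -(d * H) < -1 by linarith) zero_lt_one
    have h2 := integral_Ioi_rpow_of_lt (show -(d * H) < -1 by linarith) zero_lt_one
    refine (lintegral_mono_set (t := Set.Ioi 1) fun u hu => hu.1).trans ?_
    rw [← ofReal_integral_eq_lintegral_ofReal h1 ?_, h2]
    · refine ENNReal.ofReal_le_ofReal (le_of_eq ?_)
      rw [Real.one_rpow, show -(d * H) + 1 = -(d * H - 1) by ring, div_neg, neg_div, neg_neg]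
    · filter_upwards [ae_restrict_mem measurableSet_Ioi] with u hu
      exact Real.rpow_nonneg (zero_lt_one.trans hu).le _
  refine (partitionLowerBound_of_lintegral_le hd hH0 hH1 hβ hT (by positivity) hint).mono ?_
  have h2 : 0 ≤ β * T := by positivity
  nlinarith

open Filter Topology

/-! ### The growth function and the coefficient across regimes. -/

section Growth

lemma one_le_of_exp_one_le {T : ℝ} (hT : Real.exp 1 ≤ T) : 1 ≤ T :=
  (Real.one_le_exp zero_le_one).trans hT

lemma gammaCoeff_pos (d : ℕ) (H : ℝ) {β : ℝ} (hβ : 0 < β) : 0 < gammaCoeff d H β := by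
  unfold gammaCoeff splitPow
  split_ifs <;> positivity

lemma three_sub_pos (hH1 : H < 1) (hdH : d * H < 1) : 0 < 3 - ((d : ℝ) + 2) * H := by
  nlinarith

lemma tendsto_growthF_of_rpow {p : ℝ} (hp0 : 0 < p) (hp2 : p < 2)
    {F : ℝ → ℝ} (hF : F = fun T => T ^ p) :
    Tendsto F atTop atTop ∧ Tendsto (fun T => T ^ 2 / F T) atTop atTop := by
  subst hF
  refine ⟨tendsto_rpow_atTop hp0, ?_⟩
  refine (tendsto_rpow_atTop (sub_pos.mpr hp2)).congr' ?_
  filter_upwards [eventually_gt_atTop 0] with T hT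
  rw [Real.rpow_sub hT, Real.rpow_two]

/-- The first limit brings `N` into the range of the Gaussian tail bound; the second makes the lower
radius diverge. For `dH < 1` the exponent equals `2 (1-H)(2-dH) / (3-(d+2)H)`, and it is below 2
exactly because `d H² < 1`. -/
lemma tendsto_growthF (hd : 1 ≤ d) (hH0 : 0 < H) (hH1 : H < 1) :
    Tendsto (growthF d H) atTop atTop ∧
      Tendsto (fun T => T ^ 2 / growthF d H T) atTop atTop := by
  have hd' : (1 : ℝ) ≤ d := by exact_mod_cast hd
  by_cases h1 : d * H < 1
  · have hD := three_sub_pos hH1 h1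
    have hp : 1 + (1 - 2 * H) * (1 - d * H) / (3 - (d + 2) * H)
        = 2 * ((1 - H) * (2 - d * H)) / (3 - (d + 2) * H) := by
      rw [eq_div_iff hD.ne', add_mul, div_mul_cancel₀ _ hD.ne']; ring
    refine tendsto_growthF_of_rpow (p := 1 + (1 - 2 * H) * (1 - d * H) / (3 - (d + 2) * H))
      ?_ ?_ (by ext T; simp [growthF, h1])
    · rw [hp]
      exact div_pos (mul_pos two_pos (mul_pos (by linarith) (by linarith))) hD
    · rw [hp, div_lt_iff₀ hD]
      nlinarith [mul_lt_mul_of_pos_right h1 hH0]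
  · by_cases h2 : d * H = 1
    · by_cases h3 : H = 1 / 2
      · exact tendsto_growthF_of_rpow (p := 1) one_pos one_lt_two
          (by ext T; simp only [growthF, if_neg h1, if_pos h2, if_pos h3, Real.rpow_one])
      · have hF : growthF d H = fun T => T * Real.log T := by
          ext T; simp only [growthF, if_neg h1, if_pos h2, if_neg h3]
        rw [hF]
        refine ⟨tendsto_id.atTop_mul_atTop₀ Real.tendsto_log_atTop, ?_⟩
        have h4 : Tendsto (fun T : ℝ => T ^ (1 / 2 : ℝ) * (1 / 2)) atTop atTop :=
          (tendsto_rpow_atTop (by norm_num)).atTop_mul_const (by norm_num)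
        refine tendsto_atTop_mono' _ ?_ h4
        filter_upwards [eventually_gt_atTop 1] with T hT
        have hT0 : 0 < T := zero_lt_one.trans hT
        have hlog : 0 < Real.log T := Real.log_pos hT
        have h5 := Real.log_le_rpow_div hT0.le (show (0 : ℝ) < 1 / 2 by norm_num)
        have h6 : T ^ (1 / 2 : ℝ) * T ^ (1 / 2 : ℝ) = T := by
          rw [← Real.rpow_add hT0]; norm_num
        rw [le_div_iff₀ (by positivity)]
        have h7 : 0 < T ^ (1 / 2 : ℝ) := by positivity
        calc T ^ (1 / 2 : ℝ) * (1 / 2) * (T * Real.log T)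
            ≤ T ^ (1 / 2 : ℝ) * (1 / 2) * (T * (T ^ (1 / 2 : ℝ) / (1 / 2))) := by gcongr
          _ = T * (T ^ (1 / 2 : ℝ) * T ^ (1 / 2 : ℝ)) := by ring
          _ = T ^ 2 := by rw [h6]; ring
    · by_cases h3 : 1 / 2 ≤ H
      · exact tendsto_growthF_of_rpow (p := 2 * (2 - H) / 3) (by linarith) (by linarith)
          (by ext T; simp only [growthF, if_neg h1, if_neg h2, if_pos h3])
      · exact tendsto_growthF_of_rpow (p := 1) one_pos one_lt_two
          (by ext T; simp only [growthF, if_neg h1, if_neg h2, if_neg h3, Real.rpow_one])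

/-- This lets one drift estimate serve all `H ≥ 1/2`. There `dH < 1` forces `d = 1` and `dH = 1`
forces `d = 2`. The two sides agree except for `d = 2`, `H = 1/2`, `β ≤ 1`, where `β^{2/3} ≤
β^{1/2}`. -/
lemma le_gammaCoeff_mul_growthF (hd : 1 ≤ d) (hH : 1 / 2 ≤ H) (hH1 : H < 1) {β T : ℝ}
    (hβ : 0 < β) (hT : 1 ≤ T) :
    β ^ (2 / 3 : ℝ) * T ^ (2 * (2 - H) / 3) ≤ gammaCoeff d H β * growthF d H T := by
  have hT0 : 0 < T := zero_lt_one.trans_le hT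
  by_cases h1 : d * H < 1
  · obtain rfl : d = 1 := by
      by_contra hne
      have : (2 : ℝ) ≤ d := by exact_mod_cast (show 2 ≤ d by omega)
      nlinarith
    rw [gammaCoeff, growthF, if_pos h1, if_pos h1]
    have hne : 1 - H ≠ 0 := by linarith
    refine le_of_eq ?_
    have e0 : 3 - (((1 : ℕ) : ℝ) + 2) * H = 3 * (1 - H) := by push_cast; ring
    rw [e0]
    congr 2
    · field_simp
    · push_cast; field_simp; ring
  · by_cases h2 : d * H = 1
    · have h3 : H = 1 / 2 := by
        by_contra hne
        have hlt : 1 / 2 < H := lt_of_le_of_ne hH (Ne.symm hne)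
        have : (d : ℝ) < 2 := by
          by_contra hge
          nlinarith
        obtain rfl : d = 1 := by
          have : d < 2 := by exact_mod_cast this
          omega
        norm_num at h2; linarith
      rw [gammaCoeff, growthF, if_neg h1, if_neg h1, if_pos h2, if_pos h2, if_pos h3, if_pos h3, h3]
      norm_num
      refine mul_le_mul_of_nonneg_right ?_ hT0.le
      unfold splitPow
      split_ifs with h4
      · exact Real.rpow_le_rpow_of_exponent_ge hβ h4 (by norm_num)
      · exact le_rfl
    · rw [gammaCoeff, growthF, if_neg h1, if_neg h1, if_neg h2, if_neg h2, if_pos hH, if_pos hH]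

end Growth

/-- The lower bound on the partition function in all regimes. -/
lemma exists_partitionLowerBound (hd : 1 ≤ d) (hH0 : 0 < H) (hH1 : H < 1) :
    ∃ C : ℝ, 0 < C ∧ ∀ β : ℝ, 0 < β → ∃ T₀ : ℝ, Real.exp 1 ≤ T₀ ∧ ∀ T, T₀ ≤ T →
      PartitionLowerBound.{u} d H β T (C * gammaCoeff d H β * growthF d H T) := by
  rcases le_or_gt (1 / 2) H with hH | hH
  · obtain ⟨C, hC, h⟩ := exists_partitionLowerBound_of_one_le.{u} hd hH0 hH1
    refine ⟨2 * C, by positivity, fun β hβ => ⟨Real.exp 1, le_rfl, fun T hT => ?_⟩⟩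
    have hT1 := one_le_of_exp_one_le hT
    have hT0 : 0 < T := zero_lt_one.trans_le hT1
    -- The speed equating `β T / v` with `v² T^{2-2H}`.
    set v := β ^ (1 / 3 : ℝ) * T ^ ((2 * H - 1) / 3) with hv
    have hv0 : 0 < v := by positivity
    have e1 : β * T / v = β ^ (2 / 3 : ℝ) * T ^ (2 * (2 - H) / 3) := by
      rw [div_eq_iff hv0.ne', hv, mul_mul_mul_comm, ← Real.rpow_add hβ, ← Real.rpow_add hT0,
        show (2 / 3 + 1 / 3 : ℝ) = 1 by norm_num,
        show 2 * (2 - H) / 3 + (2 * H - 1) / 3 = 1 by ring, Real.rpow_one, Real.rpow_one]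
    have e2 : v ^ 2 * T ^ (2 - 2 * H) = β ^ (2 / 3 : ℝ) * T ^ (2 * (2 - H) / 3) := by
      rw [hv, mul_pow, ← Real.rpow_mul_natCast hβ.le, ← Real.rpow_mul_natCast hT0.le, mul_assoc,
        ← Real.rpow_add hT0]
      congr 2
      · norm_num
      · push_cast; ring
    refine (h β v T hβ hv0 hT0).mono ?_
    rw [e1, e2]
    have := mul_le_mul_of_nonneg_left (le_gammaCoeff_mul_growthF hd hH hH1 hβ hT1)
      (show 0 ≤ 2 * C by positivity)
    linarith
  · rcases lt_trichotomy ((d : ℝ) * H) 1 with hdH | hdH | hdH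
    · obtain ⟨C, hC, h⟩ := exists_partitionLowerBound_of_mul_lt_one.{u} hd hH0 hH1 hdH
      -- Beyond `β^{1/(1-2H)}` one has `β ≤ T^{1-2H}`, which is what makes the balancing speed below
      -- at most one.
      refine ⟨2 * C, by positivity, fun β hβ =>
        ⟨max (Real.exp 1) (β ^ (1 / (1 - 2 * H))), le_max_left _ _, fun T hT => ?_⟩⟩
      have hT1 := one_le_of_exp_one_le ((le_max_left _ _).trans hT)
      have hT0 : 0 < T := zero_lt_one.trans_le hT1
      have hD := three_sub_pos hH1 hdH
      have hH' : 0 < 1 - 2 * H := by linarith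
      have hH1' : 1 - H ≠ 0 := by linarith
      set D := 3 - ((d : ℝ) + 2) * H with hDdef
      set e := (1 - H) / D with he
      have he0 : 0 < e := div_pos (by linarith) hD
      have hβT : β ≤ T ^ (1 - 2 * H) := by
        have h1 := Real.rpow_le_rpow (by positivity) ((le_max_right _ _).trans hT) hH'.le
        rwa [← Real.rpow_mul hβ.le, one_div_mul_cancel hH'.ne', Real.rpow_one] at h1
      -- The speed equating `β T v^{-(1-dH)/(1-H)}` with `v² T^{2-2H}`; solving for `v` gives the
      -- exponent `e = (1-H)/D`.
      set v := β ^ e * T ^ ((2 * H - 1) * e) with hv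
      have hv0 : 0 < v := by positivity
      have hv1 : v ≤ 1 := by
        have h1 := Real.rpow_le_rpow hβ.le hβT he0.le
        calc v ≤ (T ^ (1 - 2 * H)) ^ e * T ^ ((2 * H - 1) * e) := by rw [hv]; gcongr
          _ = 1 := by
            rw [← Real.rpow_mul hT0.le, ← Real.rpow_add hT0,
              show (1 - 2 * H) * e + (2 * H - 1) * e = 0 by ring, Real.rpow_zero]
      have hg : gammaCoeff d H β * growthF d H T = β ^ (2 * (1 - H) / D)
          * T ^ (1 + (1 - 2 * H) * (1 - d * H) / D) := by
        rw [gammaCoeff, growthF, if_pos hdH, if_pos hdH]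
      have e1 : β * T * v ^ (-((1 - d * H) / (1 - H))) = β ^ (2 * (1 - H) / D)
          * T ^ (1 + (1 - 2 * H) * (1 - d * H) / D) := by
        rw [hv, Real.mul_rpow (by positivity) (by positivity), ← Real.rpow_mul hβ.le,
          ← Real.rpow_mul hT0.le, mul_mul_mul_comm]
        congr 1
        · rw [← Real.rpow_one_add' hβ.le]
          · congr 1
            rw [he]; field_simp; rw [hDdef]; ring
          · have : 1 + e * -((1 - d * H) / (1 - H)) = 2 * (1 - H) / D := by
              rw [he]; field_simp; rw [hDdef]; ring
            rw [this]; exact (div_pos (by linarith) hD).ne'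
        · rw [← Real.rpow_one_add' hT0.le]
          · congr 1
            rw [he]; field_simp; ring
          · have : 1 + (2 * H - 1) * e * -((1 - d * H) / (1 - H))
                = 1 + (1 - 2 * H) * (1 - d * H) / D := by
              rw [he]; field_simp; ring
            rw [this]
            exact (add_pos one_pos (div_pos (mul_pos hH' (by linarith)) hD)).ne'
      have e2 : v ^ 2 * T ^ (2 - 2 * H) = β ^ (2 * (1 - H) / D)
          * T ^ (1 + (1 - 2 * H) * (1 - d * H) / D) := by
        rw [hv, mul_pow, ← Real.rpow_mul_natCast hβ.le, ← Real.rpow_mul_natCast hT0.le, mul_assoc,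
          ← Real.rpow_add hT0]
        congr 2
        · rw [he]; push_cast; ring
        · rw [he]; push_cast; field_simp; rw [hDdef]; ring
      refine (h β v T hβ hv0 hv1 hT0).mono ?_
      rw [e1, e2, mul_assoc, hg]
      linarith
    · obtain ⟨C, hC, h⟩ := exists_partitionLowerBound_of_mul_eq_one.{u} hd hH0 hH1 hdH
      refine ⟨C, hC, fun β hβ => ⟨Real.exp 1, le_rfl, fun T hT => (h β T hβ hT).mono (le_of_eq ?_)⟩⟩
      rw [gammaCoeff, growthF, if_neg hdH.not_lt, if_neg hdH.not_lt, if_pos hdH, if_pos hdH,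
        if_neg hH.ne, if_neg hH.ne, mul_assoc]
    · obtain ⟨C, hC, h⟩ := exists_partitionLowerBound_of_one_lt_mul.{u} hd hH0 hH1 hdH
      refine ⟨C, hC, fun β hβ => ⟨Real.exp 1, le_rfl, fun T hT =>
        (h β T hβ (one_le_of_exp_one_le hT)).mono (le_of_eq ?_)⟩⟩
      rw [gammaCoeff, growthF, if_neg hdH.not_gt, if_neg hdH.not_gt, if_neg hdH.ne', if_neg hdH.ne',
        if_neg hH.not_ge, if_neg hH.not_ge, mul_assoc]

/-! ### The lower scale and its constant. -/

section Radii

lemma ballConst_eq (hd : 1 ≤ d) : ballConst d =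
    9 * volume.real (Metric.ball (0 : EuclideanSpace ℝ (Fin d)) 1) / 2 ^ (5 + d) := by
  have : Nonempty (Fin d) := ⟨⟨0, hd⟩⟩
  rw [ballConst, measureReal_def, EuclideanSpace.volume_ball, ENNReal.ofReal_one, one_pow, one_mul,
    Fintype.card_fin, ENNReal.toReal_ofReal
      (div_nonneg (by positivity) (Real.Gamma_nonneg_of_nonneg (by positivity))),
    Real.sqrt_eq_rpow, ← Real.rpow_mul_natCast Real.pi_pos.le, add_comm (1 : ℝ)]
  congr 5
  ring

lemma ballConst_pos (d : ℕ) : 0 < ballConst d := by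
  have : 0 < Real.Gamma (1 + (d : ℝ) / 2) := Real.Gamma_pos_of_pos (by positivity)
  unfold ballConst
  positivity

/-- The unit enlargement of the localization ball is negligible at large radii, at the price of a
factor two that enters `ballConst`. -/
lemma exists_two_mul_add_one_pow_le (d : ℕ) :
    ∃ r₀ : ℝ, 0 < r₀ ∧ ∀ r, r₀ ≤ r → (2 * r + 1) ^ d ≤ 2 * (2 * r) ^ d := by
  have h1 : Tendsto (fun r : ℝ => (1 + (2 * r)⁻¹) ^ d) atTop (𝓝 ((1 + 0) ^ d)) := by
    refine (tendsto_const_nhds.add ?_).pow d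
    exact tendsto_inv_atTop_zero.comp (tendsto_id.const_mul_atTop two_pos)
  rw [add_zero, one_pow] at h1
  obtain ⟨r₀, hr₀⟩ := eventually_atTop.mp (h1.eventually_le_const one_lt_two)
  refine ⟨max r₀ 1, by positivity, fun r hr => ?_⟩
  have hr1 : 0 < r := zero_lt_one.trans_le ((le_max_right _ _).trans hr)
  have h2 : 2 * r + 1 = (1 + (2 * r)⁻¹) * (2 * r) := by field_simp
  rw [h2, mul_pow]
  exact mul_le_mul_of_nonneg_right (hr₀ r ((le_max_left _ _).trans hr)) (by positivity)

lemma mul_lowerRadius_pow (hd : 1 ≤ d) {c β T : ℝ} (hc : 0 ≤ c)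
    (h : 0 ≤ β * T ^ 2 / (gammaCoeff d H β * growthF d H T)) :
    (c ^ (1 / (d : ℝ)) * lowerRadius d H β T) ^ d
      = c * (β * T ^ 2 / (gammaCoeff d H β * growthF d H T)) := by
  have hd0 : d ≠ 0 := by omega
  rw [lowerRadius, mul_pow, one_div, Real.rpow_inv_natCast_pow hc hd0,
    Real.rpow_inv_natCast_pow h hd0]

lemma tendsto_lowerRadius (hd : 1 ≤ d) (hH0 : 0 < H) (hH1 : H < 1) {β : ℝ} (hβ : 0 < β) :
    Tendsto (lowerRadius d H β) atTop atTop := by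
  have hd' : (0 : ℝ) < d := by exact_mod_cast hd
  have h1 := (tendsto_growthF hd hH0 hH1).2
  have h2 : Tendsto (fun T => β / gammaCoeff d H β * (T ^ 2 / growthF d H T)) atTop atTop :=
    h1.const_mul_atTop (div_pos hβ (gammaCoeff_pos d H hβ))
  refine ((tendsto_rpow_atTop (show 0 < 1 / (d : ℝ) by positivity)).comp h2).congr fun T => ?_
  rw [Function.comp_apply, lowerRadius, div_mul_div_comm]

end Radii

/-! ### From mass bounds to the repellent law. -/

section Main

variable {Ω : Type u} [MeasurableSpace Ω] {P : Measure Ω} [IsProbabilityMeasure P]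
  {B : ℝ → Ω → EuclideanSpace ℝ (Fin d)} {B' : ℝ × Ω → EuclideanSpace ℝ (Fin d)} {T : ℝ}

/-- The probability of an event under the self-repellent law, from bounds on the penalized mass of
its complement. -/
lemma one_sub_le_repellentProb
    (hBB' : (fun p : ℝ × Ω => B p.1 p.2) =ᵐ[(volume.restrict (Set.Ici 0)).prod P] B')
    (hB' : Measurable B') {β N x y c : ℝ} (hβ : 0 ≤ β) (hT : 0 ≤ T)
    (hZ : Real.exp (-N) ≤ ∫ ω, penalty β (fun t => B' (t, ω)) T ∂P)
    (hlow : ∀ᵐ ω ∂P, gyrationRadius (fun t => B' (t, ω)) T < x →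
      penalty β (fun t => B' (t, ω)) T ≤ Real.exp (-(2 * N)))
    (hc : c ≤ y ^ 2) (hy : 0 ≤ y)
    (hup : P.real {ω | c ≤ gyrationRadius (fun t => B' (t, ω)) T ^ 2} ≤ Real.exp (-(2 * N))) :
    1 - 2 * Real.exp (-N) ≤ repellentProb P B β T
      {ω | x ≤ gyrationRadius (fun t => B t ω) T ∧ gyrationRadius (fun t => B t ω) T ≤ y} := by
  have hR := measurable_gyrationRadius (T := T) hB'
  have hpi := integrable_penalty (P := P) (T := T) hB' hβ
  set R := fun ω => gyrationRadius (fun t => B' (t, ω)) T with hRdef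
  set p := fun ω => penalty β (fun t => B' (t, ω)) T with hp
  set Z := ∫ ω, p ω ∂P with hZdef
  set A := {ω | x ≤ R ω ∧ R ω ≤ y} with hA
  set S := {ω | c ≤ R ω ^ 2} with hS
  have hAm : MeasurableSet A :=
    (measurableSet_le measurable_const hR).inter (measurableSet_le hR measurable_const)
  have hSm : MeasurableSet S := measurableSet_le measurable_const (hR.pow_const 2)
  have hZ0 : 0 < Z := (Real.exp_pos _).trans_le hZ
  have hpath := ae_path_eq hBB'
  have hpart : partitionFunction P B β T = Z := by
    refine integral_congr_ae ?_
    filter_upwards [hpath] with ω hω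
    exact penalty_congr β hω
  have hind : ∫ ω, ({ω | x ≤ gyrationRadius (fun t => B t ω) T ∧
      gyrationRadius (fun t => B t ω) T ≤ y}).indicator
        (fun ω => penalty β (fun t => B t ω) T) ω ∂P = ∫ ω in A, p ω ∂P := by
    rw [← integral_indicator hAm]
    refine integral_congr_ae ?_
    filter_upwards [hpath] with ω hω
    simp only [Set.indicator, Set.mem_ofPred_eq, hA, hRdef, hp, penalty_congr β hω,
      gyrationRadius_congr hT hω]
  have hSi : Integrable (S.indicator (1 : Ω → ℝ)) P := (integrable_const (1 : ℝ)).indicator hSm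
  -- Off `A` the radius is either too small, where the penalty itself is tiny, or too large, where
  -- the penalty is bounded by one and the event is rare.
  have hcompl : ∫ ω in Aᶜ, p ω ∂P ≤ 2 * Real.exp (-(2 * N)) := by
    rw [← integral_indicator hAm.compl]
    calc ∫ ω, Aᶜ.indicator p ω ∂P
        ≤ ∫ ω, (Real.exp (-(2 * N)) + S.indicator 1 ω) ∂P := by
          refine integral_mono_ae (hpi.indicator hAm.compl)
            ((integrable_const _).add hSi) ?_
          filter_upwards [hlow] with ω hω
          have hS0 : 0 ≤ S.indicator (1 : Ω → ℝ) ω := Set.indicator_nonneg (fun _ _ => zero_le_one) ω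
          have hE0 := (Real.exp_pos (-(2 * N))).le
          by_cases hωA : ω ∈ A
          · rw [Set.indicator_of_notMem (by simpa using hωA)]
            exact add_nonneg hE0 hS0
          · rw [Set.indicator_of_mem hωA]
            by_cases hx : R ω < x
            · exact (hω hx).trans (le_add_of_nonneg_right hS0)
            · have hyR : y < R ω := by
                by_contra h
                exact hωA ⟨not_lt.mp hx, not_lt.mp h⟩
              have hmem : ω ∈ S := hc.trans (pow_le_pow_left₀ hy hyR.le 2)
              rw [Set.indicator_of_mem hmem, Pi.one_apply]
              exact (penalty_le_one hβ _).trans (le_add_of_nonneg_left hE0)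
      _ = Real.exp (-(2 * N)) + P.real S := by
          rw [integral_add (integrable_const _) hSi,
            integral_indicator_one hSm]
          simp
      _ ≤ 2 * Real.exp (-(2 * N)) := by linarith
  have hsplit := integral_add_compl hAm hpi
  rw [repellentProb, hpart, hind, one_div, ← div_eq_inv_mul, le_div_iff₀ hZ0]
  have hNN : Real.exp (-(2 * N)) = Real.exp (-N) * Real.exp (-N) := by
    rw [← Real.exp_add]; congr 1; ring
  rw [hNN] at hcompl
  -- One factor `exp (-N)` is paid to the normalization `Z`, the other is the final error.
  have := mul_le_mul_of_nonneg_left hZ (Real.exp_pos (-N)).le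
  change ∫ ω in A, p ω ∂P + ∫ ω in Aᶜ, p ω ∂P = Z at hsplit
  linarith

end Main

end SelfRepellent

open SelfRepellent in
theorem theorem1p2 (d : ℕ) (hd : 1 ≤ d) (H : ℝ) (hH0 : 0 < H) (hH1 : H < 1) :
    ∃ C₁ C₂ : ℝ, 0 < C₁ ∧ 0 < C₂ ∧
      ∀ β : ℝ, 0 < β → ∃ Tβ : ℝ, Real.exp 1 ≤ Tβ ∧
        ∀ (Ω : Type*) [MeasurableSpace Ω] (P : Measure Ω) [IsProbabilityMeasure P]
          (B : ℝ → Ω → EuclideanSpace ℝ (Fin d)),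
          IsFBM H B P →
          AEMeasurable (fun p : ℝ × Ω => B p.1 p.2) ((volume.restrict (Set.Ici 0)).prod P) →
          ∀ T : ℝ, Tβ ≤ T →
            1 - 2 * Real.exp (-(C₁ * gammaCoeff d H β * growthF d H T)) ≤
              repellentProb P B β T
                {ω | (ballConst d / (2 * C₁)) ^ (1 / (d : ℝ)) * lowerRadius d H β T ≤
                      gyrationRadius (fun t => B t ω) T ∧
                    gyrationRadius (fun t => B t ω) T ≤
                      (2 * C₁ / C₂) ^ (1 / 2 : ℝ) * upperRadius d H β T} := by
  obtain ⟨C, hC, hpart⟩ := exists_partitionLowerBound hd hH0 hH1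
  -- `C₁` is the partition function constant and `C₂ = 1/8` the rate in the Gaussian tail.
  refine ⟨C, 1 / 8, hC, by norm_num, fun β hβ => ?_⟩
  obtain ⟨T₀, hT₀, hpart⟩ := hpart β hβ
  obtain ⟨r₀, hr₀, hr⟩ := exists_two_mul_add_one_pow_le d
  have hγ := gammaCoeff_pos d H hβ
  have hb : 0 < ballConst d / (2 * C) := div_pos (ballConst_pos d) (by positivity)
  have hF := (tendsto_growthF hd hH0 hH1).1
  have hlow := (tendsto_lowerRadius hd hH0 hH1 hβ).const_mul_atTop
    (Real.rpow_pos_of_pos hb (1 / (d : ℝ)))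
  -- Three demands on `T`: `16 N ≥ 4d` for the Gaussian tail, a lower radius large enough to replace
  -- `2x + 1` by `2x`, and `F > 0`.
  have hev := ((hF.const_mul_atTop (show 0 < 16 * C * gammaCoeff d H β by positivity)).eventually_ge_atTop
    (4 * (d : ℝ))).and ((hlow.eventually_ge_atTop r₀).and (hF.eventually_gt_atTop 0))
  obtain ⟨T₁, hT₁⟩ := Filter.eventually_atTop.mp hev
  refine ⟨max T₀ T₁, hT₀.trans (le_max_left _ _), ?_⟩
  intro Ω _ P _ B hB hmeas T hT
  obtain ⟨B', hB', hBB'⟩ := hmeas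
  obtain ⟨hx, hrT, hF0⟩ := hT₁ T ((le_max_right _ _).trans hT)
  have hT0 : 0 < T := zero_lt_one.trans_le
    (one_le_of_exp_one_le (hT₀.trans ((le_max_left _ _).trans hT)))
  have hZ := hpart T ((le_max_left _ _).trans hT) Ω P B B' hB hBB' hB'
  set x := (ballConst d / (2 * C)) ^ (1 / (d : ℝ)) * lowerRadius d H β T with hxdef
  set N := C * gammaCoeff d H β * growthF d H T with hN
  have hN0 : 0 < N := by positivity
  have hx0 : 0 < x := hr₀.trans_le hrT
  have hTH : 0 < T ^ (2 * H) := by positivity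
  -- This `c` is exactly the square of the upper radius, and the tail rate `1/8` turns `16 N` into
  -- `2 N`.
  refine one_sub_le_repellentProb (c := 16 * N * T ^ (2 * H)) hBB' hB' hβ.le hT0.le hZ ?_ ?_ ?_ ?_
  · filter_upwards [hB.ae_integrableOn_sq hBB' hH0 hB' hT0] with ω hω hRx
    have h1 := le_integral_occupationTime_sq (measurable_path hB' ω) hT0 hω hx0 hRx
    rw [penalty]
    refine Real.exp_le_exp.mpr ?_
    rw [neg_mul]
    refine neg_le_neg ?_
    set K := volume.real (Metric.ball (0 : EuclideanSpace ℝ (Fin d)) 1) with hK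
    have hpow : x ^ d = ballConst d / (2 * C)
        * (β * T ^ 2 / (gammaCoeff d H β * growthF d H T)) :=
      mul_lowerRadius_pow hd hb.le (by positivity)
    have hbp := ballConst_pos d
    have hbK := ballConst_eq hd
    rw [← hK] at hbK
    have hK0 : 0 ≤ K := measureReal_nonneg
    -- The lower radius is defined so that this is an equality. The denominator `2^{5+d}` collects
    -- 16 from Cauchy-Schwarz, 2 from the enlargement of the ball and `2^d` from its radius `2x`.
    calc 2 * N = β * (ballConst d * T ^ 2 / x ^ d) := by
          rw [hpow, hN]; field_simp
      _ = β * (9 / 16 * K * T ^ 2 / (2 * (2 * x) ^ d)) := by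
          rw [hbK, mul_pow 2 x d, pow_add]; field_simp; norm_num
      _ ≤ β * (9 / 16 * K * T ^ 2 / (2 * x + 1) ^ d) := by
          have := hr x hrT
          gcongr
      _ ≤ _ := by gcongr
  · have h1 : (2 * C / (1 / 8)) = 16 * C := by ring
    rw [h1, upperRadius, ← Real.mul_rpow (by positivity) (by positivity), ← Real.sqrt_eq_rpow,
      Real.sq_sqrt (by positivity), hN]
    refine le_of_eq ?_
    ring
  · rw [upperRadius]; positivity
  · have h1 := hB.measure_gyrationRadius_ge_le hBB' hH0 hB' hT0 (x := 16 * N) (by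
      rw [hN]; linarith)
    refine h1.trans (le_of_eq ?_)
    congr 1; ring
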